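/- Let $d\ge 1$, $\sigma>0$, $\mathcal X\subseteq\mathbb R^d$, let $k(x,x')=\exp(-\|x-x'\|^2/(2\sigma^2))$ be the Gaussian kernel on $\mathcal X$, and let $\mathcal H$ be its reproducing kernel Hilbert space (of real functions on $\mathcal X$), with norm $\|\cdot\|$. For $k\in\mathbb N_0^d$ put $|k|=k_1+\dots+k_d$ and $$g_k(x)=\prod_{i=1}^d\psi_{k_i}(x^{(i)}),\qquad \psi_m(u)=\frac{u^m}{\sigma^m\sqrt{m!}}\,e^{-u^2/(2\sigma^2)},\qquad G_M=\{g_k : |k|\le M\}.$$ Let $\lambda>0$, $n\ge 1$, $R,B>0$, and let $(x_t,y_t)\in\mathcal X\times\mathbb R$ be an arbitrary sequence with $\|x_t\|\le R$ and $|y_t|\le B$ for $t=1,\dots,n$. Let $$M=\Big\lceil \max\Big(\frac{8R^2}{\sigma^2},\,2\log\frac{n}{\min(\lambda,1)}\Big)\Big\rceil .$$ PKAWV run on $G_M$ predicts $\hat y_t=\hat f_t(x_t)$ in round $t$, where $$\hat f_t=\operatorname*{argmin}_{f\in\mathrm{Span}(G_M)}\Big\{\sum_{s=1}^{t-1}(y_s-f(x_s))^2+\lambda\|f\|^2+f(x_t)^2\Big\};$$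 this minimiser exists and is unique. Its regret satisfies, for every $f\in\mathcal H$, $$\sum_{t=1}^n(y_t-\hat y_t)^2-\sum_{t=1}^n(y_t-f(x_t))^2\le\lambda\|f\|^2+\frac{3B^2}{2}\sum_{j=1}^n\log\Big(1+\frac{\lambda_j(K_{nn})}{\lambda}\Big),$$ where $\lambda_j(K_{nn})$ are the eigenvalues, with multiplicity, of $K_{nn}=(k(x_i,x_j))_{1\le i,j\le n}$. Moreover, there is a single real random-access-machine program which, given $d,M,\sigma,\lambda$ as parameters and then, online, the inputs $x_t$ and outputs $y_t$, issues in each round $t\le n$ exactly the prediction $\hat y_t$ (before $y_t$ is revealed) whenever $\mathcal X$ has non-empty interior (for instance $\mathcal X=\mathbb R^d$). The time of each round, the time of the initialisation, and the total number of memory cells used are then all at most $$C\,\Big(3+\frac1d\log\frac{n}{\min(\lambda,1)}\Big)^{2d},$$ where $C$ depends only on $d$, $R$ and $\sigma$. Here each memory access, each addition or truncated subtraction of natural numbers, each conversion of a natural number to a real number, and each real operation $+,-,\times,/,\exp,\sqrt{\cdot}$ costs one unit of time. -/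

import Mathlib

open scoped BigOperators

noncomputable section

namespace PKAWV

/-! ### Gaussian kernel, Taylor basis, and the forecaster -/

/-- The Gaussian kernel `exp (-‖x - x'‖² / (2 σ²))` on `ℝ^d`. -/
def gaussianKernel {d : ℕ} (σ : ℝ) (x x' : EuclideanSpace ℝ (Fin d)) : ℝ :=
  Real.exp (-‖x - x'‖ ^ 2 / (2 * σ ^ 2))

/-- `ψ_m(u) = u^m / (σ^m √(m!)) * exp (-u² / (2 σ²))`. -/
def psi (σ : ℝ) (m : ℕ) (u : ℝ) : ℝ :=
  u ^ m / (σ ^ m * Real.sqrt (m.factorial : ℝ)) * Real.exp (-u ^ 2 / (2 * σ ^ 2))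

/-- The Taylor function `g_k(x) = ∏ i, ψ_{k_i}(x_i)` of a multi-index `k`. -/
def taylorFun {d : ℕ} (σ : ℝ) (k : Fin d → ℕ) (x : EuclideanSpace ℝ (Fin d)) : ℝ :=
  ∏ i, psi σ (k i) (x i)

/-- The kernel matrix `(k(x_i, x_j))_{i,j < n}`. -/
def kernelMatrix {d : ℕ} {X : Set (EuclideanSpace ℝ (Fin d))} (σ : ℝ) (n : ℕ) (x : ℕ → X) :
    Matrix (Fin n) (Fin n) ℝ :=
  Matrix.of fun i j => gaussianKernel σ (x i : EuclideanSpace ℝ (Fin d)) (x j)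

theorem kernelMatrix_isHermitian {d : ℕ} {X : Set (EuclideanSpace ℝ (Fin d))} (σ : ℝ) (n : ℕ)
    (x : ℕ → X) : (kernelMatrix σ n x).IsHermitian := by
  ext i j
  simp [kernelMatrix, gaussianKernel, norm_sub_rev]

section Forecaster

variable {d : ℕ} {X : Set (EuclideanSpace ℝ (Fin d))} {H : Type*} [NormedAddCommGroup H]
  [InnerProductSpace ℝ H] [RKHS ℝ H X ℝ]

variable (H) in
/-- `Span(G_M)` inside `H`, where `G_M = {g_k : |k| ≤ M}`. -/
def taylorSpan (σ : ℝ) (M : ℕ) : Submodule ℝ H :=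
  Submodule.span ℝ {g : H | ∃ k : Fin d → ℕ, ∑ i, k i ≤ M ∧ ∀ x : X, g x = taylorFun σ k x}

/-- The objective minimised in round `t` (rounds are numbered `0, 1, 2, …`). -/
def objective (lam : ℝ) (x : ℕ → X) (y : ℕ → ℝ) (t : ℕ) (f : H) : ℝ :=
  ∑ s ∈ Finset.range t, (y s - f (x s)) ^ 2 + lam * ‖f‖ ^ 2 + f (x t) ^ 2

/-- `fhat` is the sequence of prediction functions of PKAWV with the fixed subspace `V`: in every
round `t`, `fhat t` minimises the objective over `V`. The prediction is `fhat t (x t)`. -/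
def IsPKAWV (V : Submodule ℝ H) (lam : ℝ) (x : ℕ → X) (y : ℕ → ℝ) (fhat : ℕ → H) : Prop :=
  ∀ t, fhat t ∈ V ∧ IsMinOn (objective (H := H) lam x y t) V (fhat t)

/-- Regret against `f` over the rounds `0, …, n - 1`. -/
def regret (n : ℕ) (x : ℕ → X) (y : ℕ → ℝ) (fhat : ℕ → H) (f : H) : ℝ :=
  ∑ t ∈ Finset.range n, (y t - fhat t (x t)) ^ 2 - ∑ t ∈ Finset.range n, (y t - f (x t)) ^ 2

end Forecaster

/-! ### A real random-access machine with counted loops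

The memory consists of finitely many named two-dimensional arrays of natural numbers and of real
numbers, initially zero. Reading or writing a cell, a natural-number addition or truncated
subtraction, a conversion `ℕ → ℝ`, and a real operation `+, -, *, /, exp, √` each cost one
unit of time. The space is the number of distinct cells written. -/

/-- Natural-number expressions; `load a i j` reads cell `(i, j)` of the array named `a`. -/
inductive NatExpr : Type
  | const (m : ℕ)
  | load (a : ℕ) (i j : NatExpr)
  | add (e₁ e₂ : NatExpr)
  | sub (e₁ e₂ : NatExpr)

/-- Real expressions. -/
inductive RealExpr : Type
  | ofNat (e : NatExpr)
  | load (a : ℕ) (i j : NatExpr)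
  | add (e₁ e₂ : RealExpr)
  | sub (e₁ e₂ : RealExpr)
  | mul (e₁ e₂ : RealExpr)
  | div (e₁ e₂ : RealExpr)
  | exp (e : RealExpr)
  | sqrt (e : RealExpr)

/-- Commands. `loop a b p` evaluates `b` once, to `m` say, and executes `p` for the values
`0, …, m - 1` of the counter, which is kept in cell `(0, 0)` of the natural-number array `a`. -/
inductive Cmd : Type
  | setNat (a : ℕ) (i j e : NatExpr)
  | setReal (a : ℕ) (i j : NatExpr) (e : RealExpr)
  | seq (p q : Cmd)
  | loop (a : ℕ) (b : NatExpr) (p : Cmd)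

/-- A configuration: the two memories, the time spent so far, and the cells written so far
(`false` marks natural-number cells, `true` real cells). -/
structure Config : Type where
  nat : ℕ → ℕ → ℕ → ℕ
  real : ℕ → ℕ → ℕ → ℝ
  time : ℕ
  cells : Finset (Bool × ℕ × ℕ × ℕ)

/-- Number of memory cells in use. -/
def Config.space (c : Config) : ℕ := c.cells.card

def Config.blank : Config where
  nat := fun _ _ _ => 0
  real := fun _ _ _ => 0
  time := 0
  cells := ∅

def Config.tick (c : Config) (m : ℕ) : Config := { c with time := c.time + m }

def Config.writeNat (c : Config) (a i j v : ℕ) : Config :=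
  { c with
    nat := fun a' i' j' => if a' = a ∧ i' = i ∧ j' = j then v else c.nat a' i' j'
    time := c.time + 1
    cells := insert (false, a, i, j) c.cells }

def Config.writeReal (c : Config) (a i j : ℕ) (v : ℝ) : Config :=
  { c with
    real := fun a' i' j' => if a' = a ∧ i' = i ∧ j' = j then v else c.real a' i' j'
    time := c.time + 1
    cells := insert (true, a, i, j) c.cells }

def NatExpr.eval (c : Config) : NatExpr → ℕ
  | .const m => m
  | .load a i j => c.nat a (i.eval c) (j.eval c)
  | .add e₁ e₂ => e₁.eval c + e₂.eval c
  | .sub e₁ e₂ => e₁.eval c - e₂.eval c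

def NatExpr.cost : NatExpr → ℕ
  | .const _ => 1
  | .load _ i j => i.cost + j.cost + 1
  | .add e₁ e₂ => e₁.cost + e₂.cost + 1
  | .sub e₁ e₂ => e₁.cost + e₂.cost + 1

def RealExpr.eval (c : Config) : RealExpr → ℝ
  | .ofNat e => (e.eval c : ℝ)
  | .load a i j => c.real a (i.eval c) (j.eval c)
  | .add e₁ e₂ => e₁.eval c + e₂.eval c
  | .sub e₁ e₂ => e₁.eval c - e₂.eval c
  | .mul e₁ e₂ => e₁.eval c * e₂.eval c
  | .div e₁ e₂ => e₁.eval c / e₂.eval c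
  | .exp e => Real.exp (e.eval c)
  | .sqrt e => Real.sqrt (e.eval c)

def RealExpr.cost : RealExpr → ℕ
  | .ofNat e => e.cost + 1
  | .load _ i j => i.cost + j.cost + 1
  | .add e₁ e₂ => e₁.cost + e₂.cost + 1
  | .sub e₁ e₂ => e₁.cost + e₂.cost + 1
  | .mul e₁ e₂ => e₁.cost + e₂.cost + 1
  | .div e₁ e₂ => e₁.cost + e₂.cost + 1
  | .exp e => e.cost + 1
  | .sqrt e => e.cost + 1

/-- Execution of a command. -/
def Cmd.exec : Cmd → Config → Config
  | .setNat a i j e, c =>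
      (c.tick (i.cost + j.cost + e.cost)).writeNat a (i.eval c) (j.eval c) (e.eval c)
  | .setReal a i j e, c =>
      (c.tick (i.cost + j.cost + e.cost)).writeReal a (i.eval c) (j.eval c) (e.eval c)
  | .seq p q, c => q.exec (p.exec c)
  | .loop a b p, c =>
      (List.range (b.eval c)).foldl (fun c' m => p.exec (c'.writeNat a 0 0 m))
        (c.tick (b.cost + 1))

/-- A program for the online protocol: `init` is executed once, before the first round. In each
round the input is received, `predict` is executed, the prediction is read off, the output is
received, and `update` is executed. -/
structure Program : Type where
  init : Cmd
  predict : Cmd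
  update : Cmd

/-- The parameters are stored in the cells `(0, 0)` and `(1, 0)` of the arrays named `0`. -/
def loadParams (d M : ℕ) (σ lam : ℝ) : Config :=
  (((Config.blank.writeNat 0 0 0 d).writeNat 0 1 0 M).writeReal 0 0 0 σ).writeReal 0 1 0 lam

/-- The `i`-th coordinate of the input is stored in cell `(i, 0)` of real array `1`. -/
def receiveInput {d : ℕ} (v : EuclideanSpace ℝ (Fin d)) (c : Config) : Config :=
  (List.finRange d).foldl (fun c' (i : Fin d) => c'.writeReal 1 i 0 (v i)) c

/-- The output revealed by the environment is stored in cell `(0, 0)` of real array `2`. -/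
def receiveOutput (v : ℝ) (c : Config) : Config := c.writeReal 2 0 0 v

/-- The configuration after initialisation and `t` complete rounds. -/
def Program.after (P : Program) {d : ℕ} (M : ℕ) (σ lam : ℝ) (x : ℕ → EuclideanSpace ℝ (Fin d))
    (y : ℕ → ℝ) : ℕ → Config
  | 0 => P.init.exec (loadParams d M σ lam)
  | t + 1 => P.update.exec (receiveOutput (y t)
      (P.predict.exec (receiveInput (x t) (P.after M σ lam x y t))))

/-- The prediction issued in round `t`, before `y t` is received: the content of cell `(0, 0)` of
real array `3`. -/
def Program.output (P : Program) {d : ℕ} (M : ℕ) (σ lam : ℝ) (x : ℕ → EuclideanSpace ℝ (Fin d))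
    (y : ℕ → ℝ) (t : ℕ) : ℝ :=
  (P.predict.exec (receiveInput (x t) (P.after M σ lam x y t))).real 3 0 0

/-- `P` outputs the predictions `yhat` in the rounds `0, …, n - 1`, and the initialisation, each of
these rounds, and the memory used up to the end of round `n - 1` cost at most `b`. -/
def Program.Runs (P : Program) {d : ℕ} (M : ℕ) (σ lam : ℝ) (n : ℕ)
    (x : ℕ → EuclideanSpace ℝ (Fin d)) (y yhat : ℕ → ℝ) (b : ℝ) : Prop :=
  (∀ t < n, P.output M σ lam x y t = yhat t) ∧
  ((P.after M σ lam x y 0).time : ℝ) ≤ b ∧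
  (∀ t < n, ((P.after M σ lam x y (t + 1)).time : ℝ) ≤ (P.after M σ lam x y t).time + b) ∧
  ((P.after M σ lam x y n).space : ℝ) ≤ b

end PKAWV

end

open PKAWV

/-! Regret. In an orthonormal basis of the Taylor span, the term `f(x_t)²` is an extra sample with
label zero. The forecaster is therefore ridge regression whose weights are `A_{t+1}⁻¹ b_t`, where
`A_t` is the regularised Gram matrix and `b_t` the moment vector. Comparing the optimal ridge losses
of consecutive rounds telescopes (`sum_sq_forecaster_le`). This leaves the terms `y_t² c_t / (1 +
c_t)` with leverage `c_t`, and `c / (1 + c) ≤ log (1 + c)`. The product of the `1 + c_t` is a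
determinant of the Gram matrix of the projected kernel sections. That Gram matrix lies below the
full kernel matrix in the positive semidefinite order, so determinant monotonicity gives the
eigenvalue sum (`sum_log_one_add_leverage_le`).

The comparator ranges over all of `H`, not only over the span. A duality argument (`ridge_min_le`)
bounds the price of the restriction by `n² τ B² / λ`, where `τ` is the worst squared distance of a
kernel section to the span. A Chernoff bound on the Taylor tail gives `τ ≤ e^{-M} / 8`. The choice
of `M` then makes the price at most half of the logarithmic term (`approximation_cost_le`), and `1 +
1/2` is the constant `3/2`.

Taylor functions. The Taylor features realise the Gaussian kernel in `ℓ²`, so `k(x, ·) ↦ (g_k(x))_k`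
extends to an operator `U` on `H` with `‖U‖ ≤ 1`, and the `g_k` are the images of the coordinate
vectors under its adjoint (`exists_taylorElements`). If the domain has interior points, uniqueness
of power series makes the feature vectors total in `ℓ²`, and the `g_k` are orthonormal.

Program. Orthonormality turns `‖f‖²` into the Euclidean norm of the coefficients, so the exact
predictions follow from the features alone, by Sherman–Morrison updates. With at most `(M + 1)^d`
features, a round costs the square of that number up to a factor depending on `d`. A Hoare logic
that tracks time and written cells carries the verification (`round_spec`, `forecastProgram_runs`).
-/

namespace PKAWV

/-! ### Ridge regression in coordinates: Sherman–Morrison, the telescoping loss bound, determinants.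
-/

section LinearAlgebra

open Matrix

variable {ι : Type*} [Fintype ι] [DecidableEq ι]

/-- The regularised Gram matrix `λ I + ∑ s < t, φ_s φ_sᵀ`. -/
noncomputable def regGram (lam : ℝ) (φ : ℕ → ι → ℝ) (t : ℕ) : Matrix ι ι ℝ :=
  lam • 1 + ∑ s ∈ Finset.range t, vecMulVec (φ s) (φ s)

/-- The inverse of `regGram`, by Sherman–Morrison updates. -/
noncomputable def invGram (lam : ℝ) (φ : ℕ → ι → ℝ) : ℕ → Matrix ι ι ℝ
  | 0 => lam⁻¹ • 1
  | t + 1 => invGram lam φ t - (1 + φ t ⬝ᵥ (invGram lam φ t *ᵥ φ t))⁻¹ •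
      vecMulVec (invGram lam φ t *ᵥ φ t) (invGram lam φ t *ᵥ φ t)

/-- The leverage `φ_tᵀ A_t⁻¹ φ_t`. -/
noncomputable def leverage (lam : ℝ) (φ : ℕ → ι → ℝ) (t : ℕ) : ℝ :=
  φ t ⬝ᵥ (invGram lam φ t *ᵥ φ t)

/-- The vector `∑ s < t, y_s φ_s`. -/
noncomputable def moment (φ : ℕ → ι → ℝ) (y : ℕ → ℝ) (t : ℕ) : ι → ℝ :=
  ∑ s ∈ Finset.range t, y s • φ s

variable {lam : ℝ} {φ : ℕ → ι → ℝ} {y : ℕ → ℝ}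

theorem invGram_transpose (t : ℕ) : (invGram lam φ t)ᵀ = invGram lam φ t := by
  induction t with
  | zero => simp [invGram]
  | succ t ih => simp [invGram, ih, transpose_vecMulVec]

theorem dotProduct_invGram_comm (t : ℕ) (v w : ι → ℝ) :
    v ⬝ᵥ (invGram lam φ t *ᵥ w) = (invGram lam φ t *ᵥ v) ⬝ᵥ w := by
  rw [dotProduct_mulVec, ← mulVec_transpose, invGram_transpose]

omit [Fintype ι] in
theorem regGram_succ (t : ℕ) :
    regGram lam φ (t + 1) = regGram lam φ t + vecMulVec (φ t) (φ t) := by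
  simp [regGram, Finset.sum_range_succ, add_assoc]

theorem regGram_mulVec (t : ℕ) (v : ι → ℝ) :
    regGram lam φ t *ᵥ v = lam • v + ∑ s ∈ Finset.range t, (φ s ⬝ᵥ v) • φ s := by
  simp [regGram, add_mulVec, smul_mulVec, sum_mulVec, vecMulVec_mulVec]

theorem dotProduct_regGram_nonneg (hlam : 0 < lam) (t : ℕ) (v : ι → ℝ) :
    0 ≤ v ⬝ᵥ (regGram lam φ t *ᵥ v) := by
  rw [regGram_mulVec, dotProduct_add, dotProduct_smul, dotProduct_sum]
  refine add_nonneg (smul_nonneg hlam.le ?_) (Finset.sum_nonneg fun s _ => ?_)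
  · exact Finset.sum_nonneg fun i _ => mul_self_nonneg _
  · rw [dotProduct_smul, dotProduct_comm v, smul_eq_mul]
    exact mul_self_nonneg _

/-- With `u = A⁻¹ φ`, the leverage is `u · A u`. The inverse property is a hypothesis here because
the induction that establishes it needs this sign to keep its denominator `1 + c` away from zero. -/
theorem leverage_nonneg_of_mul_eq_one (hlam : 0 < lam) {t : ℕ}
    (h : regGram lam φ t * invGram lam φ t = 1) : 0 ≤ leverage lam φ t := by
  have := dotProduct_regGram_nonneg (φ := φ) hlam t (invGram lam φ t *ᵥ φ t)
  rwa [mulVec_mulVec, h, one_mulVec, dotProduct_comm] at this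

theorem regGram_mul_invGram (hlam : 0 < lam) (t : ℕ) :
    regGram lam φ t * invGram lam φ t = 1 := by
  induction t with
  | zero => simp [regGram, invGram, hlam.ne']
  | succ t ih =>
    have hc : 1 + leverage lam φ t ≠ 0 := by
      linarith [leverage_nonneg_of_mul_eq_one hlam ih]
    have hu : regGram lam φ t *ᵥ (invGram lam φ t *ᵥ φ t) = φ t := by
      rw [mulVec_mulVec, ih, one_mulVec]
    have hv : φ t ᵥ* invGram lam φ t = invGram lam φ t *ᵥ φ t := by
      rw [← mulVec_transpose, invGram_transpose]
    change _ ≠ _ at hc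
    rw [leverage] at hc
    rw [regGram_succ, invGram, add_mul, mul_sub, mul_sub, ih, Matrix.mul_smul, Matrix.mul_smul,
      mul_vecMulVec, hu, vecMulVec_mul, hv, vecMulVec_mul_vecMulVec]
    set c := φ t ⬝ᵥ (invGram lam φ t *ᵥ φ t)
    ext i j
    simp only [Matrix.add_apply, Matrix.sub_apply, Matrix.smul_apply, vecMulVec_apply,
      Pi.smul_apply, smul_eq_mul]
    field_simp
    ring

theorem leverage_nonneg (hlam : 0 < lam) (t : ℕ) : 0 ≤ leverage lam φ t :=
  leverage_nonneg_of_mul_eq_one hlam (regGram_mul_invGram hlam t)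

theorem regGram_mulVec_invGram (hlam : 0 < lam) (t : ℕ) (b : ι → ℝ) :
    regGram lam φ t *ᵥ (invGram lam φ t *ᵥ b) = b := by
  rw [mulVec_mulVec, regGram_mul_invGram hlam, one_mulVec]

theorem invGram_succ_mulVec (t : ℕ) (b : ι → ℝ) :
    invGram lam φ (t + 1) *ᵥ b = invGram lam φ t *ᵥ b -
      ((1 + leverage lam φ t)⁻¹ * ((invGram lam φ t *ᵥ φ t) ⬝ᵥ b)) • (invGram lam φ t *ᵥ φ t) := by
  simp [invGram, sub_mulVec, smul_mulVec, vecMulVec_mulVec, leverage, smul_smul]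

/-- The forecaster weighs with the inverse that already contains the current input. By
Sherman–Morrison this only shrinks the ordinary ridge prediction by `1 + c`, so the prediction is
available before the matrix is updated. -/
theorem dotProduct_invGram_succ (hlam : 0 < lam) (t : ℕ) (b : ι → ℝ) :
    φ t ⬝ᵥ (invGram lam φ (t + 1) *ᵥ b) =
      ((invGram lam φ t *ᵥ φ t) ⬝ᵥ b) / (1 + leverage lam φ t) := by
  have hc : 1 + leverage lam φ t ≠ 0 := by linarith [leverage_nonneg (φ := φ) hlam t]
  rw [invGram_succ_mulVec, dotProduct_sub, dotProduct_smul, dotProduct_invGram_comm, ← leverage,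
    smul_eq_mul]
  field_simp
  ring

omit [Fintype ι] [DecidableEq ι] in
theorem moment_succ (t : ℕ) : moment φ y (t + 1) = moment φ y t + y t • φ t := by
  simp [moment, Finset.sum_range_succ]

/-- The cumulative loss of the forecaster is at most the regularised loss of the best weight
vector plus the sum of the squared outputs weighted by normalised leverages. -/
theorem sum_sq_forecaster_le (hlam : 0 < lam) (n : ℕ) :
    ∑ t ∈ Finset.range n, (y t - φ t ⬝ᵥ (invGram lam φ (t + 1) *ᵥ moment φ y t)) ^ 2 ≤
      (∑ t ∈ Finset.range n, y t ^ 2 - moment φ y n ⬝ᵥ (invGram lam φ n *ᵥ moment φ y n)) +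
        ∑ t ∈ Finset.range n, y t ^ 2 * (leverage lam φ t / (1 + leverage lam φ t)) := by
  induction n with
  | zero => simp [moment]
  | succ n ih =>
    rw [Finset.sum_range_succ, Finset.sum_range_succ, Finset.sum_range_succ,
      dotProduct_invGram_succ hlam]
    have hc := leverage_nonneg (φ := φ) hlam n
    set c := leverage lam φ n with hcdef
    set S := invGram lam φ n
    set b := moment φ y n
    set β := (S *ᵥ φ n) ⬝ᵥ b with hβ
    have h1 : b ⬝ᵥ (S *ᵥ φ n) = β := dotProduct_comm _ _
    have h2 : φ n ⬝ᵥ (S *ᵥ b) = β := dotProduct_invGram_comm _ _ _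
    have h4 : (S *ᵥ φ n) ⬝ᵥ φ n = c := dotProduct_comm _ _
    -- The increase of `b · A⁻¹ b` determines the change in the optimal ridge loss, which is what
    -- telescopes.
    have h3 : moment φ y (n + 1) ⬝ᵥ (invGram lam φ (n + 1) *ᵥ moment φ y (n + 1)) =
        b ⬝ᵥ (S *ᵥ b) + 2 * y n * β + y n ^ 2 * c - (β + y n * c) ^ 2 / (1 + c) := by
      rw [invGram_succ_mulVec, moment_succ]
      simp only [mulVec_add, mulVec_smul, dotProduct_add, add_dotProduct, dotProduct_smul,
        smul_dotProduct, dotProduct_sub, smul_eq_mul]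
      rw [← leverage, ← hcdef]
      simp only [show invGram lam φ n = S from rfl, show moment φ y n = b from rfl, h1, h2, h4,
        ← hβ]
      field_simp
      ring
    rw [h3]
    have key : (y n - β / (1 + c)) ^ 2 + β ^ 2 / (1 + c) - (β / (1 + c)) ^ 2 =
        y n ^ 2 - (2 * y n * β + y n ^ 2 * c - (β + y n * c) ^ 2 / (1 + c)) +
          y n ^ 2 * (c / (1 + c)) := by
      field_simp
      ring
    -- The only loss in the round: `key` is an identity, and its surplus `β² / (1 + c) - ŷ²` is
    -- nonnegative and dropped.
    have hle : (β / (1 + c)) ^ 2 ≤ β ^ 2 / (1 + c) := by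
      rw [div_pow]
      exact div_le_div_of_nonneg_left (sq_nonneg _) (by linarith) (by nlinarith)
    linarith

/-- Each round is a rank-one update, and the matrix determinant lemma contributes the factor `1 +
c`. -/
theorem det_regGram (hlam : 0 < lam) (t : ℕ) :
    (regGram lam φ t).det =
      lam ^ Fintype.card ι * ∏ s ∈ Finset.range t, (1 + leverage lam φ s) := by
  induction t with
  | zero => simp [regGram]
  | succ t ih =>
    have h : regGram lam φ (t + 1) = regGram lam φ t *
        (1 + replicateCol Unit (invGram lam φ t *ᵥ φ t) * replicateRow Unit (φ t)) := by
      rw [regGram_succ, mul_add, mul_one, ← vecMulVec_eq, mul_vecMulVec,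
        regGram_mulVec_invGram hlam]
    rw [h, det_mul, ih, det_one_add_replicateCol_mul_replicateRow, Finset.prod_range_succ,
      mul_assoc, leverage]

/-- The Gram matrix `(φ_i · φ_j)_{i,j < n}`. -/
noncomputable def featureGram (φ : ℕ → ι → ℝ) (n : ℕ) : Matrix (Fin n) (Fin n) ℝ :=
  Matrix.of fun i j => φ i ⬝ᵥ φ j

/-- Sylvester's identity `det (1 + PQ) = det (1 + QP)` passes from the feature side, of size `ι`, to
the sample side, of size `n`, where comparison with the kernel matrix is possible. -/
theorem prod_one_add_leverage (hlam : 0 < lam) (n : ℕ) :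
    ∏ s ∈ Finset.range n, (1 + leverage lam φ s) = (1 + lam⁻¹ • featureGram φ n).det := by
  let Φ : Matrix (Fin n) ι ℝ := Matrix.of fun i => φ i
  have h1 : featureGram φ n = Φ * Φᵀ := by
    ext i j
    simp [featureGram, Φ, Matrix.mul_apply, dotProduct]
  have h2 : regGram lam φ n = lam • (1 + (lam⁻¹ • Φᵀ) * Φ) := by
    rw [smul_add, Matrix.smul_mul, smul_smul, mul_inv_cancel₀ hlam.ne', one_smul, regGram]
    congr 1
    ext i j
    rw [Matrix.sum_apply, Finset.sum_range]
    simp [Φ, Matrix.mul_apply, vecMulVec_apply]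
  have h3 := det_regGram (φ := φ) hlam n
  rw [h2, det_smul, det_one_add_mul_comm, Matrix.mul_smul, ← h1] at h3
  exact (mul_left_cancel₀ (pow_ne_zero _ hlam.ne') h3).symm

/-- The factored characteristic polynomial is evaluated at `-c⁻¹` and rescaled by powers of `-c`. -/
theorem det_one_add_smul_eq_prod {A : Matrix ι ι ℝ} (hA : A.IsHermitian) {c : ℝ} (hc : c ≠ 0) :
    (1 + c • A).det = ∏ j, (1 + c * hA.eigenvalues j) := by
  have h := congrArg (Polynomial.eval (-c⁻¹)) hA.charpoly_eq
  rw [eval_charpoly, Polynomial.eval_prod] at h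
  have h1 : (1 + c • A) = (-c) • (scalar ι (-c⁻¹) - A) := by
    rw [smul_sub, scalar_apply, ← smul_one_eq_diagonal, smul_smul]
    simp [hc]
  rw [h1, det_smul, h, Fintype.card, ← Finset.prod_const, ← Finset.prod_mul_distrib]
  refine Finset.prod_congr rfl fun j _ => ?_
  simp
  field_simp
  ring

theorem one_add_sum_le_prod_one_add {κ : Type*} (s : Finset κ) {a : κ → ℝ} (ha : ∀ j, 0 ≤ a j) :
    1 + ∑ j ∈ s, a j ≤ ∏ j ∈ s, (1 + a j) := by
  classical
  induction s using Finset.induction_on with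
  | empty => simp
  | insert i s hi ih =>
    rw [Finset.sum_insert hi, Finset.prod_insert hi]
    have h0 : 0 ≤ ∑ j ∈ s, a j := Finset.sum_nonneg fun j _ => ha j
    nlinarith [ha i, mul_nonneg (ha i) h0]

theorem one_le_det_one_add {A : Matrix ι ι ℝ} (hA : A.PosSemidef) : 1 ≤ (1 + A).det := by
  have h := det_one_add_smul_eq_prod hA.isHermitian one_ne_zero
  rw [one_smul] at h
  rw [h]
  simp only [one_mul]
  exact le_trans (by linarith [Finset.sum_nonneg fun j (_ : j ∈ Finset.univ) =>
    hA.eigenvalues_nonneg j]) (one_add_sum_le_prod_one_add Finset.univ hA.eigenvalues_nonneg)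

-- Writing `E = Cᴴ C` gives `det (A + E) = det A * det (1 + C A⁻¹ Cᴴ)`, and the last factor is at
-- least one.
open scoped MatrixOrder Matrix.Norms.L2Operator in
theorem det_le_det_add {A E : Matrix ι ι ℝ} (hA : A.PosDef) (hE : E.PosSemidef) :
    A.det ≤ (A + E).det := by
  obtain ⟨C, rfl⟩ : ∃ C : Matrix ι ι ℝ, E = Cᴴ * C :=
    CStarAlgebra.nonneg_iff_eq_star_mul_self.mp hE.nonneg
  have hu : IsUnit A.det := hA.det_pos.ne'.isUnit
  rw [det_add_mul _ _ hu]
  refine le_mul_of_one_le_right hA.det_pos.le (one_le_det_one_add ?_)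
  simpa using hA.inv.posSemidef.mul_mul_conjTranspose_same C

/-- Completing the square for ridge regression. -/
theorem ridge_eq_add (T : ℕ) (z : ℕ → ℝ) (w v : ι → ℝ)
    (hv : regGram lam φ T *ᵥ v = moment φ z T) :
    ∑ s ∈ Finset.range T, (z s - φ s ⬝ᵥ w) ^ 2 + lam * (w ⬝ᵥ w) =
      ∑ s ∈ Finset.range T, (z s - φ s ⬝ᵥ v) ^ 2 + lam * (v ⬝ᵥ v) +
        (∑ s ∈ Finset.range T, (φ s ⬝ᵥ (w - v)) ^ 2 + lam * ((w - v) ⬝ᵥ (w - v))) := by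
  -- The normal equations tested against `w - v`: this is what removes the cross terms.
  have h := congrArg (fun u => (w - v) ⬝ᵥ u) hv
  simp only [regGram_mulVec, moment, dotProduct_add, dotProduct_sum, dotProduct_smul,
    smul_eq_mul] at h
  obtain ⟨δ, rfl⟩ : ∃ δ, w = v + δ := ⟨w - v, by simp⟩
  simp only [add_sub_cancel_left] at h ⊢
  have e : ∀ s, (z s - φ s ⬝ᵥ (v + δ)) ^ 2 = (z s - φ s ⬝ᵥ v) ^ 2 + (φ s ⬝ᵥ δ) ^ 2
      + 2 * ((φ s ⬝ᵥ v) * (δ ⬝ᵥ φ s)) - 2 * (z s * (δ ⬝ᵥ φ s)) := by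
    intro s
    rw [dotProduct_add, dotProduct_comm δ]
    ring
  simp only [e, Finset.sum_add_distrib, Finset.sum_sub_distrib, ← Finset.mul_sum]
  simp only [dotProduct_add, add_dotProduct, dotProduct_comm v δ]
  linarith

end LinearAlgebra

/-! ### Uniqueness of multivariate power series and products of series. -/

section PowerSeries

/-- An everywhere convergent power series that vanishes on a non-empty open set is zero. -/
theorem powerSeries_coeff_eq_zero {β : ℕ → ℝ} (hs : ∀ u : ℝ, Summable fun m => β m * u ^ m)
    {U : Set ℝ} (hU : IsOpen U) (hne : U.Nonempty) (h0 : ∀ u ∈ U, ∑' m, β m * u ^ m = 0) :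
    β = 0 := by
  set p := FormalMultilinearSeries.ofScalars ℝ β with hp
  have hr : p.radius = ⊤ := by
    refine p.radius_eq_top_of_summable_norm fun r => ?_
    refine (hs r).norm.congr fun m => ?_
    simp [hp]
  have hsum : ∀ u, p.sum u = ∑' m, β m * u ^ m := by
    intro u
    simp [hp, FormalMultilinearSeries.sum, mul_comm]
  have hfp : HasFPowerSeriesOnBall p.sum p 0 ⊤ := by
    rw [← hr]
    exact p.hasFPowerSeriesOnBall (by simp [hr])
  have han : AnalyticOnNhd ℝ p.sum Set.univ := by
    have := hfp.analyticOnNhd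
    simpa using this
  obtain ⟨u₀, hu₀⟩ := hne
  have hev : p.sum =ᶠ[nhds u₀] 0 := by
    filter_upwards [hU.mem_nhds hu₀] with u hu
    simp [hsum, h0 u hu]
  have hz := han.eqOn_zero_of_preconnected_of_eventuallyEq_zero isPreconnected_univ
    (Set.mem_univ u₀) hev
  have hp0 : p = 0 := hfp.hasFPowerSeriesAt.eq_zero_of_eventually
    (Filter.Eventually.of_forall fun u => hz (Set.mem_univ u))
  exact (FormalMultilinearSeries.ofScalars_series_eq_zero ℝ).1 hp0

/-- An everywhere convergent multivariate power series that vanishes on a non-empty open box is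
zero. -/
theorem multiPowerSeries_coeff_eq_zero {d : ℕ} {b : (Fin d → ℕ) → ℝ}
    (hs : ∀ x : Fin d → ℝ, Summable fun k => b k * ∏ i, x i ^ k i)
    {U : Fin d → Set ℝ} (hU : ∀ i, IsOpen (U i)) (hne : ∀ i, (U i).Nonempty)
    (h0 : ∀ x : Fin d → ℝ, (∀ i, x i ∈ U i) → ∑' k, b k * ∏ i, x i ^ k i = 0) : b = 0 := by
  induction d with
  | zero =>
    have := h0 default fun i => i.elim0
    rw [tsum_eq_single default fun k hk => (hk (Subsingleton.elim _ _)).elim] at this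
    funext k
    rw [Subsingleton.elim k default]
    simpa using this
  | succ d ih =>
    have hs' : ∀ (u : ℝ) (x : Fin d → ℝ), Summable fun q : ℕ × (Fin d → ℕ) =>
        u ^ q.1 * (b (Fin.cons q.1 q.2) * ∏ i, x i ^ q.2 i) := by
      intro u x
      have := (Fin.consEquiv fun _ : Fin (d + 1) => ℕ).summable_iff.2 (hs (Fin.cons u x))
      refine this.congr fun q => ?_
      simp [Fin.consEquiv, Fin.prod_univ_succ]
      ring
    have hsx : ∀ (m : ℕ) (x : Fin d → ℝ),
        Summable fun k : Fin d → ℕ => b (Fin.cons m k) * ∏ i, x i ^ k i := by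
      intro m x
      -- Taking `u = 1` makes the factor `u ^ m` disappear.
      simpa using (hs' 1 x).prod_factor m
    have key : ∀ m, (fun k : Fin d → ℕ => b (Fin.cons m k)) = 0 := by
      intro m
      refine ih (hsx m) (fun i => hU i.succ) (fun i => hne i.succ) fun x hx => ?_
      -- For frozen `x` the sum is a one-variable series in the first coordinate, whose coefficients
      -- are series in `x`. They vanish for every `x` in the smaller box, so the induction
      -- hypothesis applies to each of them.
      have hβ := powerSeries_coeff_eq_zero
        (β := fun m => ∑' k : Fin d → ℕ, b (Fin.cons m k) * ∏ i, x i ^ k i)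
        (fun u => ?_) (hU 0) (hne 0) fun u hu => ?_
      · exact congrFun hβ m
      · refine (hs' u x).prod.congr fun m => ?_
        simp only []
        rw [tsum_mul_left, mul_comm]
      · rw [← h0 (Fin.cons u x) (Fin.cases hu hx),
          ← (Fin.consEquiv fun _ : Fin (d + 1) => ℕ).tsum_eq]
        have e : ∀ q : ℕ × (Fin d → ℕ), b ((Fin.consEquiv fun _ : Fin (d + 1) => ℕ) q) *
            ∏ i, (Fin.cons u x : Fin (d + 1) → ℝ) i ^ (Fin.consEquiv (fun _ => ℕ) q) i =
            u ^ q.1 * (b (Fin.cons q.1 q.2) * ∏ i, x i ^ q.2 i) := by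
          intro q
          simp [Fin.consEquiv, Fin.prod_univ_succ]
          ring
        rw [tsum_congr e, (hs' u x).tsum_prod]
        refine tsum_congr fun m => ?_
        simp only []
        rw [tsum_mul_left, mul_comm]
    funext k
    rw [← Fin.cons_self_tail k]
    exact congrFun (key (k 0)) _

/-- A finite product of absolutely convergent series is a series over multi-indices. -/
theorem hasSum_prod_pi {d : ℕ} {f : Fin d → ℕ → ℝ} (hf : ∀ i, Summable fun m => ‖f i m‖) :
    Summable (fun k : Fin d → ℕ => ‖∏ i, f i (k i)‖) ∧
      ∑' k : Fin d → ℕ, ∏ i, f i (k i) = ∏ i, ∑' m, f i m := by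
  induction d with
  | zero =>
    refine ⟨Summable.of_finite, ?_⟩
    rw [tsum_eq_single default fun k hk => (hk (Subsingleton.elim _ _)).elim]
    simp
  | succ d ih =>
    obtain ⟨h1, h2⟩ := ih fun i => hf i.succ
    have e : ∀ q : ℕ × (Fin d → ℕ), ∏ i, f i ((Fin.consEquiv fun _ : Fin (d + 1) => ℕ) q i) =
        f 0 q.1 * ∏ i : Fin d, f i.succ (q.2 i) := by
      intro q
      simp [Fin.consEquiv, Fin.prod_univ_succ]
    constructor
    · refine (Fin.consEquiv fun _ : Fin (d + 1) => ℕ).summable_iff.1 ?_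
      exact ((hf 0).mul_norm h1).congr fun q => by rw [Function.comp_apply, e q]
    · rw [← (Fin.consEquiv fun _ : Fin (d + 1) => ℕ).tsum_eq, tsum_congr e, Fin.prod_univ_succ,
        ← h2, tsum_mul_tsum_of_summable_norm (hf 0) h1]

end PowerSeries

/-! ### Taylor expansion of the Gaussian kernel and its tail. -/

section TaylorFeatures

variable {d : ℕ}

theorem psi_mul_psi (σ : ℝ) (m : ℕ) (u v : ℝ) :
    psi σ m u * psi σ m v = (u * v / σ ^ 2) ^ m / (m.factorial : ℝ) *
      (Real.exp (-u ^ 2 / (2 * σ ^ 2)) * Real.exp (-v ^ 2 / (2 * σ ^ 2))) := by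
  have h : (Real.sqrt (m.factorial : ℝ)) ^ 2 = m.factorial := Real.sq_sqrt (Nat.cast_nonneg _)
  rw [← h, psi, psi, div_pow, mul_pow, ← pow_mul, mul_comm 2 m, pow_mul]
  simp only [div_eq_mul_inv, mul_inv, ← inv_pow]
  ring

/-- The exponential series at `θ u v / σ²`. The weight `θ` serves two purposes: `θ = 1` reproduces
the kernel, and `θ = 8` is the exponential moment in the tail bound. -/
theorem hasSum_pow_mul_psi_mul_psi {σ : ℝ} (hσ : 0 < σ) (θ u v : ℝ) :
    HasSum (fun m => θ ^ m * (psi σ m u * psi σ m v))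
      (Real.exp (((θ - 1) * (2 * u * v) - (u - v) ^ 2) / (2 * σ ^ 2))) := by
  have h := (NormedSpace.expSeries_div_hasSum_exp (𝔸 := ℝ) (θ * (u * v / σ ^ 2))).mul_right
    (Real.exp (-u ^ 2 / (2 * σ ^ 2)) * Real.exp (-v ^ 2 / (2 * σ ^ 2)))
  rw [← Real.exp_eq_exp_ℝ, ← Real.exp_add, ← Real.exp_add] at h
  have e : ((θ - 1) * (2 * u * v) - (u - v) ^ 2) / (2 * σ ^ 2) =
      θ * (u * v / σ ^ 2) + (-u ^ 2 / (2 * σ ^ 2) + -v ^ 2 / (2 * σ ^ 2)) := by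
    field_simp
    ring
  rw [e]
  have e' : (fun m => θ ^ m * (psi σ m u * psi σ m v)) = fun m => (θ * (u * v / σ ^ 2)) ^ m /
      (m.factorial : ℝ) * Real.exp (-u ^ 2 / (2 * σ ^ 2) + -v ^ 2 / (2 * σ ^ 2)) := by
    funext m
    rw [psi_mul_psi, mul_pow, Real.exp_add]
    ring
  rw [e']
  exact h

theorem summable_norm_pow_mul_psi_mul_psi {σ : ℝ} (hσ : 0 < σ) (θ u v : ℝ) :
    Summable fun m => ‖θ ^ m * (psi σ m u * psi σ m v)‖ :=
  (hasSum_pow_mul_psi_mul_psi hσ θ u v).summable.norm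

theorem prod_pow_eq_pow_sum' (θ : ℝ) (k : Fin d → ℕ) : ∏ i, θ ^ k i = θ ^ ∑ i, k i :=
  Finset.prod_pow_eq_pow_sum _ _ _

theorem pow_mul_taylorFun_mul_taylorFun (σ θ : ℝ) (k : Fin d → ℕ)
    (x z : EuclideanSpace ℝ (Fin d)) :
    ∏ i, (θ ^ k i * (psi σ (k i) (x i) * psi σ (k i) (z i))) =
      θ ^ (∑ i, k i) * (taylorFun σ k x * taylorFun σ k z) := by
  rw [Finset.prod_mul_distrib, Finset.prod_mul_distrib, prod_pow_eq_pow_sum', taylorFun, taylorFun]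

theorem hasSum_pow_mul_taylorFun {σ : ℝ} (hσ : 0 < σ) (θ : ℝ) (x z : EuclideanSpace ℝ (Fin d)) :
    HasSum (fun k : Fin d → ℕ => θ ^ (∑ i, k i) * (taylorFun σ k x * taylorFun σ k z))
      (Real.exp (((θ - 1) * (2 * inner ℝ x z) - ‖x - z‖ ^ 2) / (2 * σ ^ 2))) := by
  obtain ⟨h1, h2⟩ := hasSum_prod_pi
    (f := fun (i : Fin d) m => θ ^ m * (psi σ m (x i) * psi σ m (z i)))
    fun i => summable_norm_pow_mul_psi_mul_psi hσ θ (x i) (z i)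
  have h3 := h1.of_norm.hasSum
  rw [h2] at h3
  simp only [pow_mul_taylorFun_mul_taylorFun,
    (hasSum_pow_mul_psi_mul_psi hσ θ _ _).tsum_eq, ← Real.exp_sum] at h3
  have e : ∑ i, ((θ - 1) * (2 * x i * z i) - (x i - z i) ^ 2) / (2 * σ ^ 2) =
      ((θ - 1) * (2 * inner ℝ x z) - ‖x - z‖ ^ 2) / (2 * σ ^ 2) := by
    simp only [mul_assoc (2 : ℝ)]
    rw [← Finset.sum_div, Finset.sum_sub_distrib, ← Finset.mul_sum, ← Finset.mul_sum, EuclideanSpace.norm_sq_eq,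
      PiLp.inner_apply]
    simp [mul_comm]
  rwa [e] at h3

theorem hasSum_taylorFun_mul_taylorFun {σ : ℝ} (hσ : 0 < σ) (x z : EuclideanSpace ℝ (Fin d)) :
    HasSum (fun k : Fin d → ℕ => taylorFun σ k x * taylorFun σ k z) (gaussianKernel σ x z) := by
  simpa [gaussianKernel] using hasSum_pow_mul_taylorFun hσ 1 x z

/-- Chernoff bound for the tail of the Taylor expansion on the diagonal. -/
theorem tsum_taylorFun_sq_tail_le {σ R : ℝ} (hσ : 0 < σ) {M : ℕ} (hM : 8 * R ^ 2 / σ ^ 2 ≤ M)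
    {x : EuclideanSpace ℝ (Fin d)} (hx : ‖x‖ ≤ R) :
    ∑' k : Fin d → ℕ, (if ∑ i, k i ≤ M then 0 else taylorFun σ k x ^ 2) ≤
      Real.exp (-M) / 8 := by
  -- The base `8` fits both requirements: the weighted sum is `exp (7 ‖x‖² / σ²) ≤ exp (7 M / 8)`,
  -- and `e² < 8` gives `8^{-(M+1)} e^M ≤ e^{-M} / 8`.
  have h := hasSum_pow_mul_taylorFun hσ 8 x x
  have h' := h.mul_left ((8 : ℝ) ^ (M + 1))⁻¹
  have hle : ∀ k : Fin d → ℕ, (if ∑ i, k i ≤ M then 0 else taylorFun σ k x ^ 2) ≤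
      ((8 : ℝ) ^ (M + 1))⁻¹ * (8 ^ (∑ i, k i) * (taylorFun σ k x * taylorFun σ k x)) := by
    intro k
    have h8 : (0 : ℝ) < 8 ^ (M + 1) := by positivity
    split_ifs with hk
    · exact mul_nonneg (by positivity) (mul_nonneg (by positivity) (mul_self_nonneg _))
    · rw [← mul_assoc, inv_mul_eq_div, sq]
      refine le_mul_of_one_le_left (mul_self_nonneg _) ?_
      rw [one_le_div h8]
      exact pow_le_pow_right₀ (by norm_num) (by omega)
  have hnn : ∀ k : Fin d → ℕ, 0 ≤ (if ∑ i, k i ≤ M then 0 else taylorFun σ k x ^ 2) := by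
    intro k
    split_ifs
    · exact le_rfl
    · exact sq_nonneg _
  refine (Summable.tsum_le_tsum hle (Summable.of_nonneg_of_le hnn hle h'.summable)
    h'.summable).trans ?_
  rw [h'.tsum_eq, sub_self, norm_zero, real_inner_self_eq_norm_sq]
  have hxs : ‖x‖ ^ 2 / σ ^ 2 ≤ M / 8 := by
    have : ‖x‖ ^ 2 / σ ^ 2 ≤ R ^ 2 / σ ^ 2 := by gcongr
    have e : 8 * R ^ 2 / σ ^ 2 = 8 * (R ^ 2 / σ ^ 2) := by ring
    linarith
  have hexp : ((8 - 1) * (2 * ‖x‖ ^ 2) - (0 : ℝ) ^ 2) / (2 * σ ^ 2) ≤ M := by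
    have : ((8 - 1) * (2 * ‖x‖ ^ 2) - (0 : ℝ) ^ 2) / (2 * σ ^ 2) = 7 * (‖x‖ ^ 2 / σ ^ 2) := by
      field_simp
      ring
    have hM0 : (0 : ℝ) ≤ M := Nat.cast_nonneg _
    linarith
  have h8 : Real.exp M * Real.exp M ≤ 8 ^ M := by
    rw [← Real.exp_add, ← mul_two, mul_comm, Real.exp_mul, Real.rpow_natCast]
    refine pow_le_pow_left₀ (Real.exp_pos _).le ?_ _
    have e1 := Real.exp_one_lt_d9
    have e2 : Real.exp 2 = Real.exp 1 * Real.exp 1 := by rw [← Real.exp_add]; norm_num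
    rw [e2]
    nlinarith [Real.exp_pos 1]
  calc ((8 : ℝ) ^ (M + 1))⁻¹ * Real.exp (((8 - 1) * (2 * ‖x‖ ^ 2) - (0 : ℝ) ^ 2) / (2 * σ ^ 2))
      ≤ ((8 : ℝ) ^ (M + 1))⁻¹ * Real.exp M := by gcongr
    _ ≤ Real.exp (-M) / 8 := by
      rw [Real.exp_neg, pow_succ, inv_mul_eq_div, div_le_div_iff₀ (by positivity) (by norm_num),
        inv_mul_eq_div, le_div_iff₀ (Real.exp_pos _)]
      nlinarith

end TaylorFeatures

/-! ### The Taylor functions as elements of the reproducing kernel Hilbert space. -/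

section FeatureMap

open scoped InnerProductSpace ENNReal

variable {d : ℕ}

/-- The Taylor feature vector `(g_k(x))_k` in `ℓ²`. -/
noncomputable def taylorFeature {σ : ℝ} (hσ : 0 < σ) (x : EuclideanSpace ℝ (Fin d)) :
    lp (fun _ : Fin d → ℕ => ℝ) 2 :=
  ⟨fun k => taylorFun σ k x, memℓp_gen <| by
    simpa [sq] using (hasSum_taylorFun_mul_taylorFun hσ x x).summable⟩

theorem taylorFeature_apply {σ : ℝ} (hσ : 0 < σ) (x : EuclideanSpace ℝ (Fin d))
    (k : Fin d → ℕ) : taylorFeature hσ x k = taylorFun σ k x := rfl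

theorem inner_taylorFeature {σ : ℝ} (hσ : 0 < σ) (x z : EuclideanSpace ℝ (Fin d)) :
    ⟪taylorFeature hσ x, taylorFeature hσ z⟫_ℝ = gaussianKernel σ x z := by
  rw [lp.inner_eq_tsum, ← (hasSum_taylorFun_mul_taylorFun hσ x z).tsum_eq]
  exact tsum_congr fun k => by simp [taylorFeature_apply, mul_comm]

/-- A vector of `ℓ²` orthogonal to all Taylor feature vectors of a set with non-empty interior
vanishes. -/
theorem eq_zero_of_inner_taylorFeature {σ : ℝ} (hσ : 0 < σ)
    {X : Set (EuclideanSpace ℝ (Fin d))} (hX : (interior X).Nonempty)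
    {c : lp (fun _ : Fin d → ℕ => ℝ) 2} (hc : ∀ x ∈ X, ⟪taylorFeature hσ x, c⟫_ℝ = 0) :
    c = 0 := by
  set a : (Fin d → ℕ) → ℝ := fun k => ∏ i, (σ ^ k i * Real.sqrt ((k i).factorial : ℝ))⁻¹ with ha
  have hapos : ∀ k, a k ≠ 0 := fun k => by
    refine Finset.prod_ne_zero_iff.2 fun i _ => inv_ne_zero (mul_ne_zero (by positivity) ?_)
    exact (Real.sqrt_pos.2 (Nat.cast_pos.2 (Nat.factorial_pos _))).ne'
  -- The Gaussian factor does not depend on `k` and never vanishes; dividing it out leaves a power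
  -- series with coefficients `c k * a k`.
  have hg : ∀ (x : EuclideanSpace ℝ (Fin d)) (k : Fin d → ℕ), taylorFun σ k x =
      (∏ i, Real.exp (-(x i) ^ 2 / (2 * σ ^ 2))) * (a k * ∏ i, x i ^ k i) := by
    intro x k
    rw [taylorFun, ha, ← Finset.prod_mul_distrib, ← Finset.prod_mul_distrib]
    refine Finset.prod_congr rfl fun i _ => ?_
    rw [psi]
    ring
  have hinner : ∀ (x : EuclideanSpace ℝ (Fin d)) (k : Fin d → ℕ),
      ⟪taylorFeature hσ x k, c k⟫_ℝ = (∏ i, Real.exp (-(x i) ^ 2 / (2 * σ ^ 2))) *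
        (c k * a k * ∏ i, x i ^ k i) := by
    intro x k
    rw [taylorFeature_apply, hg]
    simp
    ring
  have hexp : ∀ x : EuclideanSpace ℝ (Fin d),
      (∏ i, Real.exp (-(x i) ^ 2 / (2 * σ ^ 2))) ≠ 0 := fun x =>
    Finset.prod_ne_zero_iff.2 fun i _ => (Real.exp_pos _).ne'
  obtain ⟨x₀, hx₀⟩ := hX
  have hopen : IsOpen ((WithLp.toLp 2 : (Fin d → ℝ) → EuclideanSpace ℝ (Fin d)) ⁻¹' interior X) :=
    isOpen_interior.preimage (PiLp.continuous_toLp 2 _)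
  obtain ⟨I, U, hIU, hsub⟩ := isOpen_pi_iff.1 hopen x₀.ofLp (by simpa using hx₀)
  have hb := multiPowerSeries_coeff_eq_zero (b := fun k => c k * a k) (fun x => ?_)
    (U := fun i => if i ∈ I then U i else Set.univ) (fun i => ?_) (fun i => ?_) (fun x hx => ?_)
  · ext k
    have := congrFun hb k
    simpa [hapos k] using this
  · have h := lp.summable_inner (𝕜 := ℝ) (taylorFeature hσ (WithLp.toLp 2 x)) c
    simp only [hinner] at h
    exact (summable_mul_left_iff (hexp _)).1 h
  · by_cases hi : i ∈ I
    · simpa [hi] using (hIU i hi).1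
    · simp [hi]
  · by_cases hi : i ∈ I
    · exact ⟨x₀.ofLp i, by simpa [hi] using (hIU i hi).2⟩
    · exact ⟨0, by simp [hi]⟩
  · have hxX : WithLp.toLp 2 x ∈ X := interior_subset (hsub fun i hi => by
      have := hx i
      rwa [if_pos (by simpa using hi)] at this)
    have h := hc _ hxX
    rw [lp.inner_eq_tsum] at h
    simp only [hinner] at h
    rw [tsum_mul_left] at h
    exact (mul_eq_zero.1 h).resolve_left (hexp _)

variable {X : Set (EuclideanSpace ℝ (Fin d))} {H : Type*} [NormedAddCommGroup H]
  [InnerProductSpace ℝ H] [CompleteSpace H] [RKHS ℝ H X ℝ]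

variable (H) in
/-- The kernel section `k(x, ·)`. -/
noncomputable def kernelSection (x : X) : H := RKHS.kerFun H x 1

theorem inner_kernelSection (x : X) (f : H) : ⟪kernelSection H x, f⟫_ℝ = f x := by
  simp [kernelSection]

theorem kernelSection_apply {σ : ℝ}
    (hk : ∀ u v : X, RKHS.kernel H u v 1 = gaussianKernel σ (u : EuclideanSpace ℝ (Fin d)) v)
    (x z : X) : kernelSection H z x = gaussianKernel σ (x : EuclideanSpace ℝ (Fin d)) z := by
  rw [kernelSection, RKHS.kerFun_apply, hk]

/-- There is a bounded operator from `H` to `ℓ²` that maps kernel sections to Taylor feature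
vectors. -/
theorem exists_featureOperator {σ : ℝ} (hσ : 0 < σ)
    (hk : ∀ u v : X, RKHS.kernel H u v 1 = gaussianKernel σ (u : EuclideanSpace ℝ (Fin d)) v) :
    ∃ U : H →L[ℝ] lp (fun _ : Fin d → ℕ => ℝ) 2, ‖U‖ ≤ 1 ∧
      ∀ x : X, U (kernelSection H x) = taylorFeature hσ (x : EuclideanSpace ℝ (Fin d)) := by
  let A : (X →₀ ℝ) →ₗ[ℝ] H := Finsupp.linearCombination ℝ (kernelSection H)
  let B : (X →₀ ℝ) →ₗ[ℝ] lp (fun _ : Fin d → ℕ => ℝ) 2 :=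
    Finsupp.linearCombination ℝ fun x : X => taylorFeature hσ (x : EuclideanSpace ℝ (Fin d))
  -- Kernel sections and feature vectors have the same Gram matrix, so `A a ↦ B a` is well defined
  -- and isometric on the dense span of the kernel sections.
  have hin : ∀ a b, ⟪B a, B b⟫_ℝ = ⟪A a, A b⟫_ℝ := by
    intro a b
    simp only [A, B, Finsupp.linearCombination_apply, Finsupp.sum_inner, Finsupp.inner_sum,
      inner_smul_left, inner_smul_right, inner_taylorFeature, inner_kernelSection,
      kernelSection_apply hk]
  have hnorm : ∀ a, ‖B a‖ ≤ 1 * ‖A a‖ := by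
    intro a
    rw [one_mul, norm_eq_sqrt_real_inner, norm_eq_sqrt_real_inner (A a), hin]
  have hdense : DenseRange A := by
    have h := RKHS.kerFun_dense (𝕜 := ℝ) H (X := X) (V := ℝ)
    rw [DenseRange, ← LinearMap.coe_range, Submodule.dense_iff_topologicalClosure_eq_top,
      ← top_le_iff, ← h]
    refine Submodule.topologicalClosure_mono (Submodule.span_le.2 ?_)
    rintro _ ⟨x, v, rfl⟩
    refine ⟨Finsupp.single x v, ?_⟩
    simp [A, kernelSection, ← map_smul]
  refine ⟨B.extendOfNorm A, LinearMap.opNorm_extendOfNorm_le hdense zero_le_one hnorm, fun x => ?_⟩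
  have := LinearMap.extendOfNorm_eq hdense ⟨1, hnorm⟩ (Finsupp.single x 1)
  simpa [A, B] using this

/-- The Taylor functions belong to `H`, span good approximations of the kernel sections, and are
orthonormal if the domain has non-empty interior. -/
theorem exists_taylorElements {σ : ℝ} (hσ : 0 < σ)
    (hk : ∀ u v : X, RKHS.kernel H u v 1 = gaussianKernel σ (u : EuclideanSpace ℝ (Fin d)) v) :
    ∃ G : (Fin d → ℕ) → H, (∀ k (x : X), G k x = taylorFun σ k x) ∧
      (∀ (x : X) (s : Finset (Fin d → ℕ)),
        ‖kernelSection H x - ∑ k ∈ s, taylorFun σ k x • G k‖ ^ 2 ≤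
          ∑' k : Fin d → ℕ, (if k ∈ s then 0 else taylorFun σ k x ^ 2)) ∧
      ((interior X).Nonempty → Orthonormal ℝ G) := by
  obtain ⟨U, hU1, hU⟩ := exists_featureOperator (H := H) hσ hk
  have hadj : ∀ (e : lp (fun _ : Fin d → ℕ => ℝ) 2) (x : X),
      (ContinuousLinearMap.adjoint U e) x =
        ⟪taylorFeature hσ (x : EuclideanSpace ℝ (Fin d)), e⟫_ℝ := by
    intro e x
    rw [← inner_kernelSection, ContinuousLinearMap.adjoint_inner_right, hU]
  have hUU : ∀ x : X, ContinuousLinearMap.adjoint U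
      (taylorFeature hσ (x : EuclideanSpace ℝ (Fin d))) = kernelSection H x := by
    intro x
    refine RKHS.ext fun z => ?_
    rw [hadj, inner_taylorFeature, kernelSection_apply hk]
  let e : (Fin d → ℕ) → lp (fun _ : Fin d → ℕ => ℝ) 2 := fun k => lp.single 2 k 1
  -- Evaluating `U* e_k` at `x` pairs `e_k` with the feature vector of `x`, which reads off the
  -- coordinate `g_k(x)`. The approximation bound is then `‖U* r‖ ≤ ‖r‖` for the truncated tail `r`.
  refine ⟨fun k => ContinuousLinearMap.adjoint U (e k), fun k x => ?_, fun x s => ?_, fun hX => ?_⟩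
  · rw [hadj]
    simp [e, lp.inner_single_right, taylorFeature_apply]
  · have h1 : kernelSection H x - ∑ k ∈ s, taylorFun σ k x • ContinuousLinearMap.adjoint U (e k) =
        ContinuousLinearMap.adjoint U (taylorFeature hσ (x : EuclideanSpace ℝ (Fin d)) -
          ∑ k ∈ s, taylorFun σ k x • e k) := by
      rw [map_sub, hUU, map_sum]
      simp
    rw [h1]
    set r := taylorFeature hσ (x : EuclideanSpace ℝ (Fin d)) - ∑ k ∈ s, taylorFun σ k x • e k
      with hr
    have h2 : ‖ContinuousLinearMap.adjoint U r‖ ≤ ‖r‖ := by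
      refine (ContinuousLinearMap.le_opNorm _ _).trans ?_
      rw [LinearIsometryEquiv.norm_map]
      exact mul_le_of_le_one_left (norm_nonneg _) hU1
    refine (pow_le_pow_left₀ (norm_nonneg _) h2 2).trans (le_of_eq ?_)
    rw [← real_inner_self_eq_norm_sq, lp.inner_eq_tsum]
    refine tsum_congr fun k => ?_
    have hrk : r k = if k ∈ s then 0 else taylorFun σ k x := by
      have : (∑ j ∈ s, taylorFun σ j x • e j) k = if k ∈ s then taylorFun σ k x else 0 := by
        rw [lp.coeFn_sum, Finset.sum_apply]
        simp [e, lp.single_apply, Pi.single_apply]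
      rw [hr, lp.coeFn_sub, Pi.sub_apply, this, taylorFeature_apply]
      split_ifs <;> simp
    rw [hrk]
    split_ifs <;> simp [sq]
  -- Since `U* U` fixes kernel sections, `U U* e_k - e_k` is orthogonal to all feature vectors of
  -- `X`; interior points force it to vanish, and then `U*` preserves the inner products of the
  -- `e_k`.
  · have hid : ∀ k, U (ContinuousLinearMap.adjoint U (e k)) = e k := by
      intro k
      rw [← sub_eq_zero]
      refine eq_zero_of_inner_taylorFeature hσ hX fun x hx => ?_
      rw [inner_sub_right, ← hU ⟨x, hx⟩, ← ContinuousLinearMap.adjoint_inner_left, hU, hUU,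
        inner_kernelSection, hadj, sub_self]
    rw [orthonormal_iff_ite]
    intro k l
    rw [ContinuousLinearMap.adjoint_inner_left, hid]
    simp [e, lp.inner_single_left, lp.single_apply, Pi.single_apply]

end FeatureMap

/-! ### The forecaster in an orthonormal basis and its regret. -/

section Regret

open scoped InnerProductSpace
open Matrix

variable {ι : Type*} [Fintype ι] [DecidableEq ι]

/-- The weights of the forecaster in round `t`. -/
noncomputable def forecastWeight (lam : ℝ) (φ : ℕ → ι → ℝ) (y : ℕ → ℝ) (t : ℕ) : ι → ℝ :=
  invGram lam φ (t + 1) *ᵥ moment φ y t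

/-- The penalty on the current prediction is one more sample with label `0`. It enters the Gram
matrix but not the moment vector, so completing the square applies with `t + 1` samples. -/
theorem forecast_loss_eq_add {lam : ℝ} (hlam : 0 < lam) (φ : ℕ → ι → ℝ) (y : ℕ → ℝ) (t : ℕ)
    (w : ι → ℝ) :
    ∑ s ∈ Finset.range t, (y s - φ s ⬝ᵥ w) ^ 2 + lam * (w ⬝ᵥ w) + (φ t ⬝ᵥ w) ^ 2 =
      (∑ s ∈ Finset.range t, (y s - φ s ⬝ᵥ forecastWeight lam φ y t) ^ 2 +
        lam * (forecastWeight lam φ y t ⬝ᵥ forecastWeight lam φ y t) +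
        (φ t ⬝ᵥ forecastWeight lam φ y t) ^ 2) +
      (∑ s ∈ Finset.range (t + 1), (φ s ⬝ᵥ (w - forecastWeight lam φ y t)) ^ 2 +
        lam * ((w - forecastWeight lam φ y t) ⬝ᵥ (w - forecastWeight lam φ y t))) := by
  set z : ℕ → ℝ := fun s => if s < t then y s else 0 with hz
  have hzs : ∀ s ∈ Finset.range t, z s = y s := fun s hs => if_pos (Finset.mem_range.1 hs)
  have hzt : z t = 0 := if_neg (lt_irrefl t)
  have hm : moment φ z (t + 1) = moment φ y t := by
    rw [moment_succ, hzt, zero_smul, add_zero]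
    exact Finset.sum_congr rfl fun s hs => by rw [hzs s hs]
  have h := ridge_eq_add (lam := lam) (φ := φ) (t + 1) z w (forecastWeight lam φ y t)
    (by rw [hm, forecastWeight, regGram_mulVec_invGram hlam])
  have hsum : ∀ v : ι → ℝ, ∑ s ∈ Finset.range (t + 1), (z s - φ s ⬝ᵥ v) ^ 2 =
      ∑ s ∈ Finset.range t, (y s - φ s ⬝ᵥ v) ^ 2 + (φ t ⬝ᵥ v) ^ 2 := by
    intro v
    rw [Finset.sum_range_succ, hzt, zero_sub, neg_sq]
    exact congrArg (· + _) (Finset.sum_congr rfl fun s hs => by rw [hzs s hs])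
  rw [hsum, hsum] at h
  linarith

variable {d : ℕ} {X : Set (EuclideanSpace ℝ (Fin d))} {H : Type*} [NormedAddCommGroup H]
  [InnerProductSpace ℝ H] [RKHS ℝ H X ℝ]

/-- The features `e_i(x_s)` of a finite family of functions in `H`. -/
noncomputable def evalFeature (e : ι → H) (x : ℕ → X) (s : ℕ) : ι → ℝ := fun i => e i (x s)

omit [DecidableEq ι] in
theorem sum_smul_apply (e : ι → H) (w : ι → ℝ) (x : X) :
    (∑ i, w i • e i) x = ∑ i, w i * e i x := by
  rw [← RKHS.coeCLM_apply, map_sum, Finset.sum_apply]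
  simp

omit [DecidableEq ι] in
theorem sum_smul_eval (e : ι → H) (w : ι → ℝ) (x : ℕ → X) (s : ℕ) :
    (∑ i, w i • e i) (x s) = evalFeature e x s ⬝ᵥ w := by
  rw [sum_smul_apply]
  exact Finset.sum_congr rfl fun i _ => mul_comm _ _

omit [DecidableEq ι] in
theorem norm_sum_smul_sq {e : ι → H} (he : Orthonormal ℝ e) (w : ι → ℝ) :
    ‖∑ i, w i • e i‖ ^ 2 = w ⬝ᵥ w := by
  rw [← real_inner_self_eq_norm_sq, he.inner_sum]
  simp [dotProduct]

omit [DecidableEq ι] in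
theorem objective_sum_smul {e : ι → H} (he : Orthonormal ℝ e) (lam : ℝ) (x : ℕ → X) (y : ℕ → ℝ)
    (t : ℕ) (w : ι → ℝ) :
    objective lam x y t (∑ i, w i • e i) =
      ∑ s ∈ Finset.range t, (y s - evalFeature e x s ⬝ᵥ w) ^ 2 + lam * (w ⬝ᵥ w) +
        (evalFeature e x t ⬝ᵥ w) ^ 2 := by
  simp only [objective, sum_smul_eval, norm_sum_smul_sq he]

omit [DecidableEq ι] in
theorem mem_span_range_iff_exists_sum (e : ι → H) {f : H} :
    f ∈ Submodule.span ℝ (Set.range e) ↔ ∃ w : ι → ℝ, ∑ i, w i • e i = f :=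
  Submodule.mem_span_range_iff_exists_fun ℝ

/-- The objective is its value at the forecaster plus a form that is positive definite because `λ >
0`; this gives existence, uniqueness and the closed form together. -/
theorem isPKAWV_iff {e : ι → H} (he : Orthonormal ℝ e) {lam : ℝ} (hlam : 0 < lam) (x : ℕ → X)
    (y : ℕ → ℝ) (fhat : ℕ → H) :
    IsPKAWV (Submodule.span ℝ (Set.range e)) lam x y fhat ↔
      fhat = fun t => ∑ i, forecastWeight lam (evalFeature e x) y t i • e i := by
  set φ := evalFeature e x
  have hmem : ∀ w : ι → ℝ, ∑ i, w i • e i ∈ Submodule.span ℝ (Set.range e) :=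
    fun w => (mem_span_range_iff_exists_sum e).2 ⟨w, rfl⟩
  have hnn : ∀ v : ι → ℝ, 0 ≤ v ⬝ᵥ v := fun v => Finset.sum_nonneg fun i _ => mul_self_nonneg _
  have hobj : ∀ t (w : ι → ℝ), objective lam x y t (∑ i, w i • e i) =
      objective lam x y t (∑ i, forecastWeight lam φ y t i • e i) +
      (∑ s ∈ Finset.range (t + 1), (φ s ⬝ᵥ (w - forecastWeight lam φ y t)) ^ 2 +
        lam * ((w - forecastWeight lam φ y t) ⬝ᵥ (w - forecastWeight lam φ y t))) := by
    intro t w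
    rw [objective_sum_smul he, objective_sum_smul he]
    exact forecast_loss_eq_add hlam φ y t w
  constructor
  · intro h
    funext t
    obtain ⟨hV, hmin⟩ := h t
    obtain ⟨w, hw⟩ := (mem_span_range_iff_exists_sum e).1 hV
    have h1 := hmin (hmem (forecastWeight lam φ y t))
    rw [Set.mem_ofPred_eq, ← hw, hobj t w] at h1
    have h2 : 0 ≤ ∑ s ∈ Finset.range (t + 1), (φ s ⬝ᵥ (w - forecastWeight lam φ y t)) ^ 2 :=
      Finset.sum_nonneg fun s _ => sq_nonneg _
    have h3 := hnn (w - forecastWeight lam φ y t)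
    have h4 : (w - forecastWeight lam φ y t) ⬝ᵥ (w - forecastWeight lam φ y t) = 0 := by
      nlinarith
    rw [← hw, sub_eq_zero.1 (dotProduct_self_eq_zero.1 h4)]
  · rintro rfl t
    refine ⟨hmem _, fun f hf => ?_⟩
    obtain ⟨w, rfl⟩ := (mem_span_range_iff_exists_sum e).1 hf
    rw [Set.mem_ofPred_eq, hobj t w]
    exact le_add_of_nonneg_right (add_nonneg (Finset.sum_nonneg fun s _ => sq_nonneg _)
      (mul_nonneg hlam.le (hnn _)))

/-- The loss of the best weight vector in terms of its normal equations. -/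
theorem ridge_min_eq {lam : ℝ} (hlam : 0 < lam) (φ : ℕ → ι → ℝ) (y : ℕ → ℝ) (n : ℕ) :
    ∑ t ∈ Finset.range n, y t ^ 2 - moment φ y n ⬝ᵥ (invGram lam φ n *ᵥ moment φ y n) =
      ∑ t ∈ Finset.range n, (y t - φ t ⬝ᵥ (invGram lam φ n *ᵥ moment φ y n)) ^ 2 +
        lam * ((invGram lam φ n *ᵥ moment φ y n) ⬝ᵥ (invGram lam φ n *ᵥ moment φ y n)) := by
  set g := invGram lam φ n *ᵥ moment φ y n with hg
  have hA : regGram lam φ n *ᵥ g = moment φ y n := regGram_mulVec_invGram hlam n _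
  have h0 := ridge_eq_add (lam := lam) (φ := φ) n y 0 g hA
  have h1 : moment φ y n ⬝ᵥ g = lam * (g ⬝ᵥ g) + ∑ s ∈ Finset.range n, (φ s ⬝ᵥ g) ^ 2 := by
    rw [← hA, dotProduct_comm, regGram_mulVec, dotProduct_add, dotProduct_smul, dotProduct_sum]
    refine congrArg₂ _ rfl (Finset.sum_congr rfl fun s _ => ?_)
    rw [dotProduct_smul, dotProduct_comm g, smul_eq_mul, sq]
  simp only [dotProduct_zero, sub_zero, zero_sub, dotProduct_neg, neg_dotProduct, neg_sq,
    mul_zero, add_zero, neg_neg] at h0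
  rw [h1]
  linarith

variable [CompleteSpace H]

/-- Minimising over a subspace that approximates the kernel sections instead of the whole space
costs little. -/
theorem ridge_min_le {e : ι → H} (he : Orthonormal ℝ e) {lam : ℝ} (hlam : 0 < lam)
    {x : ℕ → X} {y : ℕ → ℝ} {n : ℕ} {τ B : ℝ}
    (hτ : ∀ t < n, ‖kernelSection H (x t) - ∑ i, evalFeature e x t i • e i‖ ^ 2 ≤ τ)
    (hy : ∀ t < n, |y t| ≤ B) (f : H) :
    ∑ t ∈ Finset.range n, y t ^ 2 - moment (evalFeature e x) y n ⬝ᵥ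
        (invGram lam (evalFeature e x) n *ᵥ moment (evalFeature e x) y n) ≤
      ∑ t ∈ Finset.range n, (y t - f (x t)) ^ 2 + lam * ‖f‖ ^ 2 + n ^ 2 * τ * B ^ 2 / lam := by
  set φ := evalFeature e x with hφ
  rw [ridge_min_eq hlam]
  set g := invGram lam φ n *ᵥ moment φ y n with hg
  have hA : regGram lam φ n *ᵥ g = moment φ y n := regGram_mulVec_invGram hlam n _
  have hgg : 0 ≤ g ⬝ᵥ g := Finset.sum_nonneg fun i _ => mul_self_nonneg _
  -- The residuals of the restricted minimiser serve as a dual point for the unrestricted problem.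
  -- With `h = ∑ r_s k(x_s, ·)`, the normal equations say that `λ G` is the projection of `h` onto
  -- the span, and `ρ` is the remainder.
  set r : ℕ → ℝ := fun s => y s - φ s ⬝ᵥ g with hr
  have hlg : lam • g = ∑ s ∈ Finset.range n, r s • φ s := by
    rw [regGram_mulVec, moment] at hA
    simp only [hr, sub_smul, Finset.sum_sub_distrib]
    rw [← hA, add_sub_cancel_right]
  have hrg : ∑ s ∈ Finset.range n, r s * (φ s ⬝ᵥ g) = lam * (g ⬝ᵥ g) := by
    rw [← smul_eq_mul lam, ← smul_dotProduct, hlg, sum_dotProduct]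
    exact Finset.sum_congr rfl fun s _ => by rw [smul_dotProduct, smul_eq_mul]
  set h : H := ∑ s ∈ Finset.range n, r s • kernelSection H (x s) with hh
  set G : H := ∑ i, g i • e i with hG
  have hin : ∀ f' : H, ⟪h, f'⟫_ℝ = ∑ s ∈ Finset.range n, r s * f' (x s) := by
    intro f'
    simp [hh, sum_inner, inner_smul_left, inner_kernelSection]
  have hGn : ‖G‖ ^ 2 = g ⬝ᵥ g := norm_sum_smul_sq he g
  set ρ := h - lam • G with hρ
  have hρs : ρ = ∑ s ∈ Finset.range n, r s • (kernelSection H (x s) - ∑ i, φ s i • e i) := by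
    have : lam • G = ∑ s ∈ Finset.range n, r s • ∑ i, φ s i • e i := by
      simp only [Finset.smul_sum, smul_smul, hG]
      rw [Finset.sum_comm]
      refine Finset.sum_congr rfl fun i _ => ?_
      rw [← Finset.sum_smul]
      have := congrFun hlg i
      simp only [Pi.smul_apply, smul_eq_mul, Finset.sum_apply] at this
      rw [this]
    rw [hρ, this, hh, ← Finset.sum_sub_distrib]
    simp only [smul_sub]
  have hhn : ‖h‖ ^ 2 = lam ^ 2 * (g ⬝ᵥ g) + ‖ρ‖ ^ 2 := by
    have h1 : h = ρ + lam • G := by simp [hρ]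
    have hG1 : ⟪h, G⟫_ℝ = lam * (g ⬝ᵥ g) := by
      rw [hin, ← hrg]
      exact Finset.sum_congr rfl fun s _ => by rw [hG, sum_smul_eval]
    have h2 : ⟪ρ, lam • G⟫_ℝ = 0 := by
      rw [hρ, inner_sub_left, inner_smul_right, inner_smul_left, inner_smul_right, hG1,
        real_inner_self_eq_norm_sq, hGn]
      simp
    rw [h1, norm_add_sq_real, h2, norm_smul, mul_pow, hGn, Real.norm_eq_abs, sq_abs]
    ring
  -- Comparison of the minimiser with the zero weight vector.
  have hrsum : ∑ s ∈ Finset.range n, r s ^ 2 ≤ n * B ^ 2 := by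
    have h0 := ridge_eq_add (lam := lam) (φ := φ) n y 0 g hA
    have h2 : 0 ≤ ∑ s ∈ Finset.range n, (φ s ⬝ᵥ g) ^ 2 := Finset.sum_nonneg fun s _ => sq_nonneg _
    simp only [dotProduct_zero, sub_zero, zero_sub, dotProduct_neg, neg_dotProduct, neg_sq,
      mul_zero, add_zero, neg_neg] at h0
    have h3 : ∑ s ∈ Finset.range n, y s ^ 2 ≤ n * B ^ 2 := by
      refine (Finset.sum_le_card_nsmul _ _ (B ^ 2) fun s hs => ?_).trans (by simp)
      exact sq_le_sq' (by linarith [abs_le.1 (hy s (Finset.mem_range.1 hs))])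
        (abs_le.1 (hy s (Finset.mem_range.1 hs))).2
    have h4 := mul_nonneg hlam.le hgg
    simp only [hr]
    linarith
  have hρn : ‖ρ‖ ^ 2 ≤ n ^ 2 * τ * B ^ 2 := by
    by_cases hn : n = 0
    · subst hn
      simp [hρs]
    have hτ0 : 0 ≤ τ := (sq_nonneg _).trans (hτ 0 (Nat.pos_of_ne_zero hn))
    have h1 : ‖ρ‖ ≤ ∑ s ∈ Finset.range n,
        |r s| * ‖kernelSection H (x s) - ∑ i, φ s i • e i‖ := by
      rw [hρs]
      refine (norm_sum_le _ _).trans (le_of_eq (Finset.sum_congr rfl fun s _ => ?_))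
      rw [norm_smul, Real.norm_eq_abs]
    calc ‖ρ‖ ^ 2 ≤ (∑ s ∈ Finset.range n,
          |r s| * ‖kernelSection H (x s) - ∑ i, φ s i • e i‖) ^ 2 :=
          pow_le_pow_left₀ (norm_nonneg _) h1 2
      _ ≤ n * ∑ s ∈ Finset.range n,
          (|r s| * ‖kernelSection H (x s) - ∑ i, φ s i • e i‖) ^ 2 := by
          simpa using sq_sum_le_card_mul_sum_sq (s := Finset.range n)
            (f := fun s => |r s| * ‖kernelSection H (x s) - ∑ i, φ s i • e i‖)
      _ ≤ n * ∑ s ∈ Finset.range n, r s ^ 2 * τ := by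
          refine mul_le_mul_of_nonneg_left (Finset.sum_le_sum fun s hs => ?_) (Nat.cast_nonneg _)
          rw [mul_pow, sq_abs]
          exact mul_le_mul_of_nonneg_left (hτ s (Finset.mem_range.1 hs)) (sq_nonneg _)
      _ ≤ n * ((n * B ^ 2) * τ) := by
          rw [← Finset.sum_mul]
          gcongr
      _ = n ^ 2 * τ * B ^ 2 := by ring
  -- Weak duality: the square is bounded below by its tangent at `r s`, and `hnorm` bounds the
  -- resulting linear functional of `f` by Young's inequality. Only `‖ρ‖² / λ` separates this bound
  -- from the restricted minimum.
  have hlow : ∀ s, 2 * (r s * y s) - 2 * (r s * f (x s)) - r s ^ 2 ≤ (y s - f (x s)) ^ 2 := by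
    intro s
    nlinarith [sq_nonneg (y s - f (x s) - r s)]
  have hlow' := Finset.sum_le_sum fun s (_ : s ∈ Finset.range n) => hlow s
  simp only [Finset.sum_sub_distrib, ← Finset.mul_sum] at hlow'
  rw [← hin f] at hlow'
  have hry : ∑ s ∈ Finset.range n, r s * y s = ∑ s ∈ Finset.range n, r s ^ 2 + lam * (g ⬝ᵥ g) := by
    rw [← hrg, ← Finset.sum_add_distrib]
    exact Finset.sum_congr rfl fun s _ => by simp only [hr]; ring
  have hnorm : 2 * ⟪h, f⟫_ℝ ≤ lam * ‖f‖ ^ 2 + ‖h‖ ^ 2 / lam := by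
    have h1 := sq_nonneg ‖lam • f - h‖
    rw [norm_sub_sq_real, norm_smul, mul_pow, Real.norm_eq_abs, sq_abs, inner_smul_left,
      real_inner_comm] at h1
    simp only [conj_trivial] at h1
    have h2 : 2 * ⟪h, f⟫_ℝ * lam ≤ (lam * ‖f‖ ^ 2 + ‖h‖ ^ 2 / lam) * lam := by
      rw [add_mul, div_mul_cancel₀ _ hlam.ne']
      nlinarith
    exact le_of_mul_le_mul_right h2 hlam
  have hdiv : ‖h‖ ^ 2 / lam = lam * (g ⬝ᵥ g) + ‖ρ‖ ^ 2 / lam := by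
    rw [hhn]
    field_simp
  have hρd : ‖ρ‖ ^ 2 / lam ≤ n ^ 2 * τ * B ^ 2 / lam := div_le_div_of_nonneg_right hρn hlam.le
  have hrr : ∑ t ∈ Finset.range n, (y t - φ t ⬝ᵥ g) ^ 2 = ∑ s ∈ Finset.range n, r s ^ 2 := rfl
  rw [hrr]
  linarith

/-- Kernel sections split orthogonally into a part in the span and a remainder. The kernel matrix is
the feature Gram matrix plus the Gram matrix of the remainders, so its determinant dominates. -/
theorem sum_log_one_add_leverage_le {e : ι → H} (he : Orthonormal ℝ e) {lam : ℝ} (hlam : 0 < lam)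
    {σ : ℝ} (hk : ∀ u v : X, RKHS.kernel H u v 1 =
      gaussianKernel σ (u : EuclideanSpace ℝ (Fin d)) v) (x : ℕ → X) (n : ℕ) :
    ∑ t ∈ Finset.range n, Real.log (1 + leverage lam (evalFeature e x) t) ≤
      ∑ j, Real.log (1 + (kernelMatrix_isHermitian σ n x).eigenvalues j / lam) := by
  set φ := evalFeature e x
  have hgram : kernelMatrix σ n x = gram ℝ fun i : Fin n => kernelSection H (x i) := by
    ext i j
    rw [gram_apply, inner_kernelSection, kernelSection_apply hk]
    rfl
  have hpos : (kernelMatrix σ n x).PosSemidef := hgram ▸ posSemidef_gram ℝ _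
  have hfg : featureGram φ n = gram ℝ fun i : Fin n => ∑ l, φ i l • e l := by
    ext i j
    rw [gram_apply, he.inner_sum]
    simp [featureGram, dotProduct]
  have hdiff : kernelMatrix σ n x - featureGram φ n =
      gram ℝ fun i : Fin n => kernelSection H (x i) - ∑ l, φ i l • e l := by
    ext i j
    have h1 : ⟪kernelSection H (x i), ∑ l, φ j l • e l⟫_ℝ = φ i ⬝ᵥ φ j := by
      rw [inner_kernelSection, sum_smul_eval]
    have h2 : ⟪∑ l, φ i l • e l, kernelSection H (x j)⟫_ℝ = φ i ⬝ᵥ φ j := by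
      rw [real_inner_comm, inner_kernelSection, sum_smul_eval, dotProduct_comm]
    have h3 := congrFun (congrFun hfg i) j
    have h4 := congrFun (congrFun hgram i) j
    rw [gram_apply] at h3 h4
    rw [gram_apply, inner_sub_left, inner_sub_right, inner_sub_right, h1, h2, ← h3, ← h4,
      Matrix.sub_apply]
    simp [featureGram]
  have hdet : (1 + lam⁻¹ • featureGram φ n).det ≤ (1 + lam⁻¹ • kernelMatrix σ n x).det := by
    have hA : (1 + lam⁻¹ • featureGram φ n).PosDef :=
      PosDef.one.add_posSemidef ((hfg ▸ posSemidef_gram ℝ _ : (featureGram φ n).PosSemidef).smul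
        (inv_nonneg.2 hlam.le))
    have := det_le_det_add hA ((hdiff ▸ posSemidef_gram ℝ _ :
      (kernelMatrix σ n x - featureGram φ n).PosSemidef).smul (inv_nonneg.2 hlam.le))
    rwa [add_assoc, ← smul_add, add_sub_cancel] at this
  have hlev : ∀ t, 0 < 1 + leverage lam φ t := fun t => by linarith [leverage_nonneg (φ := φ) hlam t]
  rw [← Real.log_prod fun t _ => (hlev t).ne', ← Real.log_prod fun j _ => ?_,
    prod_one_add_leverage hlam]
  · rw [det_one_add_smul_eq_prod (kernelMatrix_isHermitian σ n x) (inv_ne_zero hlam.ne')] at hdet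
    simp only [inv_mul_eq_div] at hdet
    refine Real.log_le_log ?_ hdet
    rw [← prod_one_add_leverage hlam]
    exact Finset.prod_pos fun t _ => hlev t
  · have := hpos.eigenvalues_nonneg j
    have := div_nonneg this hlam.le
    positivity

/-- Regret bound for the forecaster on the span of an orthonormal family that approximates the
kernel sections. -/
theorem regret_le {e : ι → H} (he : Orthonormal ℝ e) {lam : ℝ} (hlam : 0 < lam)
    {σ : ℝ} (hk : ∀ u v : X, RKHS.kernel H u v 1 =
      gaussianKernel σ (u : EuclideanSpace ℝ (Fin d)) v) {x : ℕ → X} {y : ℕ → ℝ} {n : ℕ} {τ B : ℝ}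
    (hτ : ∀ t < n, ‖kernelSection H (x t) - ∑ i, evalFeature e x t i • e i‖ ^ 2 ≤ τ)
    (hy : ∀ t < n, |y t| ≤ B) {fhat : ℕ → H}
    (hf : IsPKAWV (Submodule.span ℝ (Set.range e)) lam x y fhat) (f : H) :
    regret n x y fhat f ≤ lam * ‖f‖ ^ 2 + n ^ 2 * τ * B ^ 2 / lam + B ^ 2 *
      ∑ j, Real.log (1 + (kernelMatrix_isHermitian σ n x).eigenvalues j / lam) := by
  rw [(isPKAWV_iff he hlam x y fhat).1 hf, regret]
  simp only [sum_smul_eval]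
  set φ := evalFeature e x
  have h1 := sum_sq_forecaster_le (φ := φ) (y := y) hlam n
  have h2 := ridge_min_le he hlam hτ hy f
  have h3 : ∑ t ∈ Finset.range n, y t ^ 2 * (leverage lam φ t / (1 + leverage lam φ t)) ≤
      B ^ 2 * ∑ t ∈ Finset.range n, Real.log (1 + leverage lam φ t) := by
    rw [Finset.mul_sum]
    refine Finset.sum_le_sum fun t ht => ?_
    have hc := leverage_nonneg (φ := φ) hlam t
    refine mul_le_mul ?_ ?_ (by positivity) (sq_nonneg _)
    · rw [← sq_abs]
      exact pow_le_pow_left₀ (abs_nonneg _) (hy t (Finset.mem_range.1 ht)) 2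
    -- `c / (1 + c) = 1 - (1 + c)⁻¹ ≤ log (1 + c)`.
    · refine le_trans (le_of_eq ?_) (Real.one_sub_inv_le_log_of_pos (by linarith))
      field_simp
      ring
  have h4 := mul_le_mul_of_nonneg_left (sum_log_one_add_leverage_le he hlam hk x n) (sq_nonneg B)
  simp only [forecastWeight]
  linarith

/-- With Taylor order `M ≥ 2 log (n / min(λ, 1))` the approximation cost is at most half of the
logarithmic term. -/
theorem approximation_cost_le {lam σ : ℝ} (hlam : 0 < lam) {n M : ℕ} (hn : 1 ≤ n)
    (hM : 2 * Real.log (n / min lam 1) ≤ M) (x : ℕ → X)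
    (hpos : (kernelMatrix σ n x).PosSemidef) :
    n ^ 2 * (Real.exp (-M) / 8) / lam ≤
      (∑ j, Real.log (1 + (kernelMatrix_isHermitian σ n x).eigenvalues j / lam)) / 2 := by
  set hA := kernelMatrix_isHermitian σ n x
  have hnR : (1 : ℝ) ≤ n := by exact_mod_cast hn
  have ha : ∀ j, 0 ≤ hA.eigenvalues j / lam := fun j =>
    div_nonneg (hpos.eigenvalues_nonneg j) hlam.le
  -- The Gaussian kernel is `1` on the diagonal; hence the logarithmic term is at least `log (1 + n
  -- / λ)`, against which the cost is measured.
  have htr : ∑ j, hA.eigenvalues j = n := by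
    have h := hA.trace_eq_sum_eigenvalues
    simp only [RCLike.ofReal_real_eq_id, id_eq] at h
    rw [← h]
    simp [Matrix.trace, kernelMatrix, gaussianKernel]
  have h1 : Real.log (1 + n / lam) ≤ ∑ j, Real.log (1 + hA.eigenvalues j / lam) := by
    rw [← Real.log_prod fun j _ => by linarith [ha j]]
    refine Real.log_le_log (by positivity) ?_
    refine le_trans (le_of_eq ?_) (one_add_sum_le_prod_one_add Finset.univ ha)
    rw [← Finset.sum_div, htr]
  have hmin : 0 < min lam 1 := lt_min hlam one_pos
  -- The logarithmic lower bound on `M` is chosen to cancel the factor `n²`, leaving `min(λ, 1)² /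
  -- (8 λ)`.
  have h2 : Real.exp (-M) ≤ (min lam 1 / n) ^ 2 := by
    have : Real.exp (-M) ≤ Real.exp (-(2 * Real.log (n / min lam 1))) :=
      Real.exp_le_exp.2 (neg_le_neg hM)
    refine this.trans (le_of_eq ?_)
    rw [show -(2 * Real.log (n / min lam 1)) = (2 : ℕ) * Real.log (min lam 1 / n) by
      rw [← inv_div, Real.log_inv]; push_cast; ring]
    rw [Real.exp_nat_mul, Real.exp_log (by positivity)]
  have h3 : (n : ℝ) ^ 2 * (Real.exp (-M) / 8) / lam ≤ (min lam 1) ^ 2 / lam / 8 := by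
    have : (n : ℝ) ^ 2 * (Real.exp (-M) / 8) ≤ (n : ℝ) ^ 2 * ((min lam 1 / n) ^ 2 / 8) := by gcongr
    refine (div_le_div_of_nonneg_right this hlam.le).trans (le_of_eq ?_)
    field_simp
  have h4 : (min lam 1) ^ 2 / lam ≤ 2 * Real.log (1 + n / lam) := by
    have hle : Real.log (1 + 1 / lam) ≤ Real.log (1 + n / lam) := by
      refine Real.log_le_log (by positivity) ?_
      gcongr
    -- The right side is `2 / (1 + λ)`. The minimum with `1` handles small `λ`, where the left side
    -- is `λ`, and large `λ`, where it is `1 / λ`.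
    have h5 : (min lam 1) ^ 2 / lam ≤ 2 * (1 - (1 + 1 / lam)⁻¹) := by
      have e : 1 - (1 + 1 / lam)⁻¹ = 1 / (1 + lam) := by
        field_simp
        ring
      rw [e, mul_one_div, div_le_div_iff₀ hlam (by linarith)]
      rcases le_total lam 1 with h | h
      · rw [min_eq_left h]
        nlinarith [mul_nonneg hlam.le (sub_nonneg.2 h)]
      · rw [min_eq_right h]
        linarith
    have h6 := Real.one_sub_inv_le_log_of_pos (x := 1 + 1 / lam) (by positivity)
    linarith
  have h7 : 0 ≤ Real.log (1 + n / lam) := Real.log_nonneg (by simp; positivity)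
  linarith

end Regret

/-! ### Enumeration of multi-indices and level-by-level products. -/

section Enumeration

/-- The list of the multi-indices `k : Fin d → ℕ` with `|k| ≤ M`. -/
def multiIndices (M : ℕ) : (d : ℕ) → List (Fin d → ℕ)
  | 0 => [Fin.elim0]
  | d + 1 => (multiIndices M d).flatMap fun k =>
      (List.range (M - ∑ i, k i + 1)).map fun m => Fin.snoc k m

theorem sum_snoc {d : ℕ} (k : Fin d → ℕ) (m : ℕ) :
    ∑ i, (Fin.snoc k m : Fin (d + 1) → ℕ) i = ∑ i, k i + m := by
  rw [Fin.sum_univ_castSucc]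
  simp

theorem mem_multiIndices {M d : ℕ} {k : Fin d → ℕ} : k ∈ multiIndices M d ↔ ∑ i, k i ≤ M := by
  induction d with
  | zero => simp [multiIndices, Subsingleton.elim k Fin.elim0]
  | succ d ih =>
    simp only [multiIndices, List.mem_flatMap, List.mem_map, List.mem_range]
    constructor
    · rintro ⟨k', hk', m, hm, rfl⟩
      have := ih.1 hk'
      rw [sum_snoc]
      omega
    · intro h
      rw [Fin.sum_univ_castSucc] at h
      refine ⟨Fin.init k, ih.2 ?_, k (Fin.last d), ?_, Fin.snoc_init_self k⟩
      · exact (Nat.le_add_right _ _).trans h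
      · simp only [Fin.init]
        omega

theorem nodup_multiIndices (M d : ℕ) : (multiIndices M d).Nodup := by
  induction d with
  | zero => simp [multiIndices]
  | succ d ih =>
    rw [multiIndices, List.nodup_flatMap]
    refine ⟨fun k _ => List.nodup_range.map fun m m' h => ?_, ih.imp fun {k k'} hne => ?_⟩
    · simpa using congrFun h (Fin.last d)
    · rw [Function.onFun, List.disjoint_left]
      intro l hl hl'
      obtain ⟨m, _, rfl⟩ := List.mem_map.1 hl
      obtain ⟨m', _, h⟩ := List.mem_map.1 hl'
      refine hne ?_
      have := congrArg Fin.init h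
      simpa using this.symm

variable (σ : ℝ) (x : ℕ → ℝ)

/-- The extensions of a pair of a residual degree and a partial product by the coordinate `i`. -/
noncomputable def extendLevel (i : ℕ) (p : ℕ × ℝ) : List (ℕ × ℝ) :=
  (List.range (p.1 + 1)).map fun m => (p.1 - m, p.2 * psi σ m (x i))

/-- The residual degrees and partial products of the Taylor functions, for the first `i`
coordinates. -/
noncomputable def featureLevel (M : ℕ) : ℕ → List (ℕ × ℝ)
  | 0 => [(M, 1)]
  | i + 1 => (featureLevel M i).flatMap (extendLevel σ x i)

/-- Both lists are extended by one coordinate at a time in the same order. The residual degree `M -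
|k|` is exactly the largest exponent still allowed in the next coordinate. -/
theorem featureLevel_eq_map (M i : ℕ) :
    featureLevel σ x M i =
      (multiIndices M i).map fun k => (M - ∑ j, k j, ∏ j : Fin i, psi σ (k j) (x j)) := by
  induction i with
  | zero => simp [featureLevel, multiIndices]
  | succ i ih =>
    rw [featureLevel, ih, multiIndices, List.flatMap_map, List.map_flatMap]
    refine List.flatMap_congr fun k _ => ?_
    rw [extendLevel, List.map_map]
    refine List.map_congr_left fun m _ => ?_
    simp only [Function.comp_apply, sum_snoc, Fin.prod_univ_castSucc, Fin.snoc_castSucc,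
      Fin.snoc_last, Fin.val_castSucc, Fin.val_last, Prod.mk.injEq, and_true]
    omega

theorem length_featureLevel (M i : ℕ) :
    (featureLevel σ x M i).length = (multiIndices M i).length := by
  rw [featureLevel_eq_map, List.length_map]

theorem fst_le_of_mem_featureLevel {M i : ℕ} {p : ℕ × ℝ} (hp : p ∈ featureLevel σ x M i) :
    p.1 ≤ M := by
  rw [featureLevel_eq_map, List.mem_map] at hp
  obtain ⟨k, _, rfl⟩ := hp
  exact Nat.sub_le _ _

theorem length_flatMap_extendLevel_le {M : ℕ} {l : List (ℕ × ℝ)} (hl : ∀ p ∈ l, p.1 ≤ M) (i : ℕ) :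
    (l.flatMap (extendLevel σ x i)).length ≤ l.length * (M + 1) := by
  induction l with
  | nil => simp
  | cons p l ih =>
    have h1 := ih fun q hq => hl q (List.mem_cons_of_mem _ hq)
    have h2 := hl p List.mem_cons_self
    simp only [List.flatMap_cons, List.length_append, List.length_cons, extendLevel,
      List.length_map, List.length_range] at h1 ⊢
    rw [Nat.succ_mul]
    omega

theorem length_featureLevel_le (M i : ℕ) : (featureLevel σ x M i).length ≤ (M + 1) ^ i := by
  induction i with
  | zero => simp [featureLevel]
  | succ i ih =>
    refine (length_flatMap_extendLevel_le σ x (fun p hp => fst_le_of_mem_featureLevel σ x hp)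
      i).trans ?_
    rw [pow_succ]
    exact Nat.mul_le_mul_right _ ih

theorem psi_zero (u : ℝ) : psi σ 0 u = Real.exp (-u ^ 2 / (2 * σ ^ 2)) := by
  simp [psi]

/-- The recursion that lets the program reach the next exponent in constant time, without computing
powers or factorials. -/
theorem psi_succ (m : ℕ) (u : ℝ) :
    psi σ (m + 1) u = psi σ m u * u / (σ * Real.sqrt ((m + 1 : ℕ) : ℝ)) := by
  rw [psi, psi, Nat.factorial_succ, Nat.cast_mul, Real.sqrt_mul (Nat.cast_nonneg _), pow_succ,
    pow_succ]
  simp only [div_eq_mul_inv, mul_inv]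
  ring

end Enumeration

/-! ### Hoare triples with time and memory bounds. -/

section ProgramLogic

/-- Update of a two-dimensional array. -/
def updCell {α : Type*} (f : ℕ → ℕ → α) (i j : ℕ) (v : α) : ℕ → ℕ → α :=
  fun i' j' => if i' = i ∧ j' = j then v else f i' j'

/-- Update of a cell in a memory. -/
def setCell {α : Type*} (m : ℕ → ℕ → ℕ → α) (a i j : ℕ) (v : α) : ℕ → ℕ → ℕ → α :=
  fun a' i' j' => if a' = a ∧ i' = i ∧ j' = j then v else m a' i' j'

variable {α : Type*}

theorem updCell_same (f : ℕ → ℕ → α) (i j : ℕ) (v : α) : updCell f i j v i j = v := by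
  simp [updCell]

theorem updCell_of_ne (f : ℕ → ℕ → α) {i j i' j' : ℕ} (v : α) (h : ¬(i' = i ∧ j' = j)) :
    updCell f i j v i' j' = f i' j' := if_neg h

theorem setCell_same (m : ℕ → ℕ → ℕ → α) (a i j : ℕ) (v : α) :
    setCell m a i j v a = updCell (m a) i j v := by
  funext i' j'
  simp [setCell, updCell]

theorem setCell_of_ne (m : ℕ → ℕ → ℕ → α) {a a' : ℕ} (i j : ℕ) (v : α) (h : a' ≠ a) :
    setCell m a i j v a' = m a' := by
  funext i' j'
  simp [setCell, h]

section Configuration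

variable (c : Config) (a i j v k : ℕ) (w : ℝ)

theorem writeNat_nat : (c.writeNat a i j v).nat = setCell c.nat a i j v := rfl
theorem writeNat_real : (c.writeNat a i j v).real = c.real := rfl
theorem writeNat_time : (c.writeNat a i j v).time = c.time + 1 := rfl
theorem writeNat_cells : (c.writeNat a i j v).cells = insert (false, a, i, j) c.cells := rfl
theorem writeReal_nat : (c.writeReal a i j w).nat = c.nat := rfl
theorem writeReal_real : (c.writeReal a i j w).real = setCell c.real a i j w := rfl
theorem writeReal_time : (c.writeReal a i j w).time = c.time + 1 := rfl
theorem writeReal_cells : (c.writeReal a i j w).cells = insert (true, a, i, j) c.cells := rfl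
theorem tick_nat : (c.tick k).nat = c.nat := rfl
theorem tick_real : (c.tick k).real = c.real := rfl
theorem tick_time : (c.tick k).time = c.time + k := rfl
theorem tick_cells : (c.tick k).cells = c.cells := rfl

end Configuration

/-- The cells with array name below `20` and indices below `N`. -/
def cellBox (N : ℕ) : Finset (Bool × ℕ × ℕ × ℕ) :=
  Finset.univ ×ˢ Finset.range 20 ×ˢ Finset.range N ×ˢ Finset.range N

theorem card_cellBox (N : ℕ) : (cellBox N).card = 40 * N ^ 2 := by
  simp [cellBox]
  ring

theorem insert_subset_cellBox {N : ℕ} {s : Finset (Bool × ℕ × ℕ × ℕ)} {q : Bool} {a i j : ℕ}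
    (ha : a < 20) (hi : i < N) (hj : j < N) (hs : s ⊆ cellBox N) :
    insert (q, a, i, j) s ⊆ cellBox N :=
  Finset.insert_subset (by simp [cellBox, ha, hi, hj]) hs

/-- Assertions about the two memories. -/
abbrev Assertion := (ℕ → ℕ → ℕ → ℕ) → (ℕ → ℕ → ℕ → ℝ) → Prop

/-- Started in a state that satisfies `P`, the command `p` ends after at most `T` time units in a
state that satisfies `Q`, and it only writes cells in `cellBox N`. -/
def Hoare (N : ℕ) (P : Assertion) (p : Cmd) (T : ℕ) (Q : Assertion) : Prop :=
  ∀ c : Config, P c.nat c.real → c.cells ⊆ cellBox N →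
    Q (p.exec c).nat (p.exec c).real ∧ (p.exec c).time ≤ c.time + T ∧
      (p.exec c).cells ⊆ cellBox N

variable {N : ℕ} {P Q R : Assertion}

theorem Hoare.mono {p : Cmd} {T T' : ℕ} {P' Q' : Assertion} (h : Hoare N P p T Q)
    (hP : ∀ n r, P' n r → P n r) (hQ : ∀ n r, Q n r → Q' n r) (hT : T ≤ T') :
    Hoare N P' p T' Q' := by
  intro c hc hb
  obtain ⟨h1, h2, h3⟩ := h c (hP _ _ hc) hb
  exact ⟨hQ _ _ h1, h2.trans (by omega), h3⟩

theorem Hoare.seq {p q : Cmd} {T₁ T₂ : ℕ} (h₁ : Hoare N P p T₁ Q) (h₂ : Hoare N Q q T₂ R) :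
    Hoare N P (.seq p q) (T₁ + T₂) R := by
  intro c hc hb
  obtain ⟨h1, h2, h3⟩ := h₁ c hc hb
  obtain ⟨h4, h5, h6⟩ := h₂ _ h1 h3
  exact ⟨h4, by rw [Cmd.exec]; omega, h6⟩

theorem Hoare.setNat {a T : ℕ} {i j e : NatExpr} (ha : a < 20)
    (hT : i.cost + j.cost + e.cost + 1 ≤ T)
    (h : ∀ c : Config, P c.nat c.real → i.eval c < N ∧ j.eval c < N ∧
      Q (setCell c.nat a (i.eval c) (j.eval c) (e.eval c)) c.real) :
    Hoare N P (.setNat a i j e) T Q := by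
  intro c hc hb
  obtain ⟨h1, h2, h3⟩ := h c hc
  exact ⟨h3, by rw [Cmd.exec, writeNat_time, tick_time]; omega,
    insert_subset_cellBox ha h1 h2 hb⟩

theorem Hoare.setReal {a T : ℕ} {i j : NatExpr} {e : RealExpr} (ha : a < 20)
    (hT : i.cost + j.cost + e.cost + 1 ≤ T)
    (h : ∀ c : Config, P c.nat c.real → i.eval c < N ∧ j.eval c < N ∧
      Q c.nat (setCell c.real a (i.eval c) (j.eval c) (e.eval c))) :
    Hoare N P (.setReal a i j e) T Q := by
  intro c hc hb
  obtain ⟨h1, h2, h3⟩ := h c hc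
  exact ⟨h3, by rw [Cmd.exec, writeReal_time, tick_time]; omega,
    insert_subset_cellBox ha h1 h2 hb⟩

/-- Rule for loops whose invariant does not mention the counter. -/
theorem Hoare.loop {a : ℕ} {b : NatExpr} {p : Cmd} {K T : ℕ} (I : ℕ → Assertion) (hN : 0 < N)
    (ha : a < 20) (hb : ∀ c : Config, I 0 c.nat c.real → b.eval c = K)
    (hset : ∀ m < K, ∀ n r, I m n r → I m (setCell n a 0 0 m) r)
    (hbody : ∀ m < K, Hoare N (fun n r => I m n r ∧ n a 0 0 = m) p T (I (m + 1))) :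
    Hoare N (I 0) (.loop a b p) (b.cost + 1 + K * (T + 1)) (I K) := by
  intro c hc hcells
  have key : ∀ k ≤ K,
      let c' := (List.range k).foldl (fun c' m => p.exec (c'.writeNat a 0 0 m))
        (c.tick (b.cost + 1))
      I k c'.nat c'.real ∧ c'.time ≤ c.time + (b.cost + 1 + k * (T + 1)) ∧
        c'.cells ⊆ cellBox N := by
    intro k
    induction k with
    | zero => exact fun _ => ⟨hc, by simp [tick_time], hcells⟩
    | succ k ih =>
      intro hk
      obtain ⟨h1, h2, h3⟩ := ih (by omega)
      simp only [List.range_succ, List.foldl_append, List.foldl_cons, List.foldl_nil]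
      set c' := (List.range k).foldl (fun c' m => p.exec (c'.writeNat a 0 0 m))
        (c.tick (b.cost + 1))
      obtain ⟨h4, h5, h6⟩ := hbody k (by omega) (c'.writeNat a 0 0 k)
        ⟨hset k (by omega) _ _ h1, by rw [writeNat_nat, setCell_same, updCell_same]⟩
        (insert_subset_cellBox ha hN hN h3)
      refine ⟨h4, h5.trans ?_, h6⟩
      rw [writeNat_time, Nat.succ_mul]
      omega
  have hexec : (Cmd.loop a b p).exec c =
      (List.range K).foldl (fun c' m => p.exec (c'.writeNat a 0 0 m)) (c.tick (b.cost + 1)) := by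
    rw [Cmd.exec, hb c hc]
  rw [hexec]
  exact key K le_rfl

end ProgramLogic

/-! ### Verification of the feature computation. -/

section FeatureProgram

/-- The counter kept in the natural-number array `a`. -/
def counter (a : ℕ) : NatExpr := .load a (.const 0) (.const 0)

/-- The scalar kept in the real array `a`. -/
def scalar (a : ℕ) : RealExpr := .load a (.const 0) (.const 0)

/-- Append the current partial product to the next level and pass to the next exponent. -/
def appendFeature : Cmd :=
  .seq (.setReal 4 (.add (counter 3) (.const 1))
      (.load 2 (.add (counter 3) (.const 1)) (.const 0)) (scalar 9))
    (.seq (.setNat 1 (.add (counter 3) (.const 1))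
        (.load 2 (.add (counter 3) (.const 1)) (.const 0))
        (.sub (.load 1 (counter 3) (counter 4)) (counter 5)))
      (.seq (.setReal 9 (.const 0) (.const 0)
          (.div (.mul (scalar 9) (.load 1 (counter 3) (.const 0)))
            (.mul (scalar 0) (.sqrt (.ofNat (.add (counter 5) (.const 1)))))))
        (.setNat 2 (.add (counter 3) (.const 1)) (.const 0)
          (.add (.load 2 (.add (counter 3) (.const 1)) (.const 0)) (.const 1)))))

/-- Compute the partial product with exponent `0` in the current coordinate. -/
def startFeature : Cmd :=
  .setReal 9 (.const 0) (.const 0)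
    (.mul (.load 4 (counter 3) (counter 4))
      (.exp (.div (.sub (.ofNat (.const 0))
          (.mul (.load 1 (counter 3) (.const 0)) (.load 1 (counter 3) (.const 0))))
        (.mul (.ofNat (.const 2)) (.mul (scalar 0) (scalar 0))))))

/-- Compute all Taylor features of the input, coordinate by coordinate. The residual degrees are
kept in the natural-number array `1`, the lengths of the levels in the natural-number array `2`
and the partial products in the real array `4`. -/
def computeFeatures : Cmd :=
  .seq (.setNat 1 (.const 0) (.const 0) (.load 0 (.const 1) (.const 0)))
    (.seq (.setReal 4 (.const 0) (.const 0) (.ofNat (.const 1)))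
      (.seq (.setNat 2 (.const 0) (.const 0) (.const 1))
        (.loop 3 (.load 0 (.const 0) (.const 0))
          (.seq (.setNat 2 (.add (counter 3) (.const 1)) (.const 0) (.const 0))
            (.loop 4 (.load 2 (counter 3) (.const 0))
              (.seq startFeature
                (.loop 5 (.add (.load 1 (counter 3) (counter 4)) (.const 1)) appendFeature)))))))

/-- The arrays hold the list `l` as level `i`. -/
def HasLevel (rem len : ℕ → ℕ → ℕ) (val : ℕ → ℕ → ℝ) (i : ℕ) (l : List (ℕ × ℝ)) : Prop :=
  len i 0 = l.length ∧ ∀ j (h : j < l.length), rem i j = l[j].1 ∧ val i j = l[j].2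

theorem HasLevel.nil {rem len : ℕ → ℕ → ℕ} {val : ℕ → ℕ → ℝ} {i : ℕ} (h : len i 0 = 0) :
    HasLevel rem len val i [] := ⟨h, fun j hj => by simp at hj⟩

theorem HasLevel.append {rem len : ℕ → ℕ → ℕ} {val : ℕ → ℕ → ℝ} {i : ℕ} {l : List (ℕ × ℝ)}
    (h : HasLevel rem len val i l) (p : ℕ × ℝ) :
    HasLevel (updCell rem i l.length p.1) (updCell len i 0 (l.length + 1))
      (updCell val i l.length p.2) i (l ++ [p]) := by
  refine ⟨by simp [updCell_same], fun j hj => ?_⟩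
  rcases Nat.lt_or_ge j l.length with hlt | hge
  · rw [updCell_of_ne _ _ (by omega), updCell_of_ne _ _ (by omega), List.getElem_append_left hlt]
    exact h.2 j hlt
  · obtain rfl : j = l.length := by
      simp at hj
      omega
    simp [updCell_same]

theorem HasLevel.congr {rem rem' len len' : ℕ → ℕ → ℕ} {val val' : ℕ → ℕ → ℝ} {i : ℕ}
    {l : List (ℕ × ℝ)} (h : HasLevel rem len val i l) (h1 : rem' i = rem i) (h2 : len' i = len i)
    (h3 : val' i = val i) : HasLevel rem' len' val' i l := by
  rw [HasLevel, h1, h2, h3]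
  exact h

theorem updCell_row_of_ne {α : Type*} (f : ℕ → ℕ → α) {i i' : ℕ} (j : ℕ) (v : α) (h : i' ≠ i) :
    updCell f i j v i' = f i' := by
  funext j'
  exact updCell_of_ne _ _ fun h' => h h'.1

variable (N₀ : ℕ → ℕ → ℕ) (R₀ : ℕ → ℕ → ℕ → ℝ)

/-- The levels computed from the parameters and the input in memory. -/
noncomputable def memoryLevel (i : ℕ) : List (ℕ × ℝ) :=
  featureLevel (R₀ 0 0 0) (fun i => R₀ 1 i 0) (N₀ 1 0) i

/-- The memory is unchanged, except for the arrays used in the computation of the features. -/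
def FeatureFrame (n : ℕ → ℕ → ℕ → ℕ) (r : ℕ → ℕ → ℕ → ℝ) : Prop :=
  n 0 = N₀ ∧ ∀ a, a ≠ 4 → a ≠ 9 → r a = R₀ a

/-- Invariant of the loop over the exponents. -/
def ExponentInv (i j : ℕ) (l pre : List (ℕ × ℝ)) (p : ℕ × ℝ) (m : ℕ) : Assertion := fun n r =>
  FeatureFrame N₀ R₀ n r ∧ n 3 0 0 = i ∧ n 4 0 0 = j ∧ HasLevel (n 1) (n 2) (r 4) i l ∧
    HasLevel (n 1) (n 2) (r 4) (i + 1)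
      (pre ++ (List.range m).map fun m => (p.1 - m, p.2 * psi (R₀ 0 0 0) m (R₀ 1 i 0))) ∧
    r 9 0 0 = p.2 * psi (R₀ 0 0 0) m (R₀ 1 i 0)

/-- The new entry goes to position `pre.length + m`, the length of the next level before it is
incremented. The running product is stored before it advances from exponent `m` to `m + 1`. -/
theorem hoare_appendFeature {N i j m : ℕ} {l pre : List (ℕ × ℝ)} (hj : j < l.length)
    (hi : i + 1 < N) (hm : pre.length + m < N) :
    Hoare N (fun n r => ExponentInv N₀ R₀ i j l pre l[j] m n r ∧ n 5 0 0 = m) appendFeature 80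
      (ExponentInv N₀ R₀ i j l pre l[j] (m + 1)) := by
  rintro c ⟨⟨⟨hn0, hr0⟩, h3, h4, hl, hl', h9⟩, h5⟩ hcells
  have hlen := hl'.1
  have hrem := (hl.2 j hj).1
  have hx : c.real 1 i 0 = R₀ 1 i 0 := by rw [hr0 1 (by decide) (by decide)]
  have hσ : c.real 0 0 0 = R₀ 0 0 0 := by rw [hr0 0 (by decide) (by decide)]
  simp only [List.length_append, List.length_map, List.length_range] at hlen
  have hN : 0 < N := by omega
  have happ := hl'.append (l[j].1 - m, l[j].2 * psi (R₀ 0 0 0) m (R₀ 1 i 0))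
  simp only [List.length_append, List.length_map, List.length_range] at happ
  have hii : i ≠ i + 1 := by omega
  refine ⟨⟨⟨?_, ?_⟩, ?_, ?_, ?_, ?_, ?_⟩, ?_, ?_⟩
  · simpa [appendFeature, Cmd.exec, writeNat_nat, writeReal_nat, tick_nat, setCell_of_ne] using hn0
  · intro a ha ha'
    simpa [appendFeature, Cmd.exec, writeNat_real, writeReal_real, tick_real, setCell_of_ne, ha,
      ha'] using hr0 a ha ha'
  · simpa [appendFeature, Cmd.exec, writeNat_nat, writeReal_nat, tick_nat, setCell_of_ne] using h3
  · simpa [appendFeature, Cmd.exec, writeNat_nat, writeReal_nat, tick_nat, setCell_of_ne] using h4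
  · refine hl.congr ?_ ?_ ?_ <;>
      simp [appendFeature, Cmd.exec, writeNat_nat, writeReal_nat, tick_nat, writeNat_real,
        writeReal_real, tick_real, setCell_of_ne, setCell_same, counter, NatExpr.eval, h3,
        updCell_row_of_ne _ _ _ hii]
  · rw [List.range_succ, List.map_append, ← List.append_assoc]
    simpa [appendFeature, Cmd.exec, writeNat_nat, writeReal_nat, tick_nat, writeNat_real,
        writeReal_real, tick_real, setCell_of_ne, setCell_same, counter, scalar, NatExpr.eval,
        RealExpr.eval, h3, h4, h5, hlen, hrem, h9] using happ
  · simp [appendFeature, Cmd.exec, writeNat_nat, writeReal_nat, tick_nat, writeNat_real,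
        writeReal_real, tick_real, setCell_of_ne, setCell_same, updCell_same, counter, scalar,
        NatExpr.eval, RealExpr.eval, h3, h5, h9, hx, hσ, psi_succ]
    ring
  · simp [appendFeature, Cmd.exec, writeNat_time, writeReal_time, tick_time, counter, scalar,
      NatExpr.cost, RealExpr.cost]
  · simp only [appendFeature, Cmd.exec, writeNat_cells, writeReal_cells, tick_cells, counter,
      NatExpr.eval, writeNat_nat, writeReal_nat, tick_nat, h3]
    refine insert_subset_cellBox (by norm_num) ?_ hN (insert_subset_cellBox (by norm_num) hN hN
      (insert_subset_cellBox (by norm_num) ?_ ?_ (insert_subset_cellBox (by norm_num) ?_ ?_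
        hcells))) <;>
      (try simp only [setCell_of_ne _ _ _ _ (show 3 ≠ 1 by decide), h3, hlen]) <;> omega

/-- Invariant of the loop over the entries of a level. -/
def EntryInv (i j : ℕ) : Assertion := fun n r =>
  FeatureFrame N₀ R₀ n r ∧ n 3 0 0 = i ∧
    HasLevel (n 1) (n 2) (r 4) i (memoryLevel N₀ R₀ i) ∧
    HasLevel (n 1) (n 2) (r 4) (i + 1) (((memoryLevel N₀ R₀ i).take j).flatMap
      (extendLevel (R₀ 0 0 0) (fun i => R₀ 1 i 0) i))

theorem hoare_entry {N i j : ℕ} (hj : j < (memoryLevel N₀ R₀ i).length) (hi : i + 1 < N)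
    (hlen : (memoryLevel N₀ R₀ (i + 1)).length < N) :
    Hoare N (fun n r => EntryInv N₀ R₀ i j n r ∧ n 4 0 0 = j)
      (.seq startFeature
        (.loop 5 (.add (.load 1 (counter 3) (counter 4)) (.const 1)) appendFeature))
      (80 * (N₀ 1 0 + 1) + (N₀ 1 0 + 1) + 100) (EntryInv N₀ R₀ i (j + 1)) := by
  set l := memoryLevel N₀ R₀ i with hl
  set f := extendLevel (R₀ 0 0 0) (fun i => R₀ 1 i 0) i with hf
  set pre := (l.take j).flatMap f with hpre
  have hfj : f l[j] = (List.range (l[j].1 + 1)).map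
      fun m => (l[j].1 - m, l[j].2 * psi (R₀ 0 0 0) m (R₀ 1 i 0)) := rfl
  have htake : (l.take (j + 1)).flatMap f = pre ++ f l[j] := by
    rw [List.take_succ_eq_append_getElem hj, List.flatMap_append]
    simp [hpre]
  -- The entries written so far and those about to be written form a prefix of level `i + 1`, whose
  -- length is below `N`.
  have hbound : pre.length + (l[j].1 + 1) < N := by
    have h1 : (memoryLevel N₀ R₀ (i + 1)) =
        (l.take (j + 1)).flatMap f ++ (l.drop (j + 1)).flatMap f := by
      rw [← List.flatMap_append, List.take_append_drop]
      rfl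
    rw [h1, List.length_append, htake, List.length_append, hfj, List.length_map,
      List.length_range] at hlen
    omega
  have hM : l[j].1 ≤ N₀ 1 0 := fst_le_of_mem_featureLevel _ _ (List.getElem_mem hj)
  have hN : 0 < N := by omega
  have hstart : Hoare N (fun n r => EntryInv N₀ R₀ i j n r ∧ n 4 0 0 = j) startFeature
      40 (ExponentInv N₀ R₀ i j l pre l[j] 0) := by
    refine Hoare.setReal (T := 40) (by norm_num) (by decide) ?_
    rintro c ⟨⟨⟨hn0, hr0⟩, h3, hl1, hl2⟩, h4⟩
    have hx : c.real 1 i 0 = R₀ 1 i 0 := by rw [hr0 1 (by decide) (by decide)]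
    have hσ : c.real 0 0 0 = R₀ 0 0 0 := by rw [hr0 0 (by decide) (by decide)]
    have hv := (hl1.2 j hj).2
    refine ⟨hN, hN, ⟨hn0, fun a ha ha' => ?_⟩, h3, h4, ?_, ?_, ?_⟩
    · rw [setCell_of_ne _ _ _ _ ha']
      exact hr0 a ha ha'
    · simpa [setCell_of_ne] using hl1
    · simpa [setCell_of_ne] using hl2
    · simp [setCell_same, updCell_same, NatExpr.eval, RealExpr.eval, counter, scalar, h3, h4, hx,
        hσ, hv, psi_zero, sq]
      rfl
  have hloop := Hoare.loop (N := N) (a := 5)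
    (b := .add (.load 1 (counter 3) (counter 4)) (.const 1)) (p := appendFeature)
    (K := l[j].1 + 1) (T := 80)
    (ExponentInv N₀ R₀ i j l pre l[j]) hN (by norm_num) ?_ ?_ ?_
  · refine (hstart.seq hloop).mono (fun _ _ h => h) ?_ ?_
    · rintro n r ⟨h1, h2, _, h4, h5, _⟩
      refine ⟨h1, h2, h4, ?_⟩
      rw [← hl, ← hf, htake, hfj]
      exact h5
    · simp only [NatExpr.cost, counter]
      nlinarith
  · rintro c ⟨_, h3, h4, h5, _⟩
    simp [NatExpr.eval, counter, h3, h4, (h5.2 j hj).1]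
  · rintro m _ n r ⟨⟨h1, h1'⟩, h3, h4, h5, h6, h9⟩
    exact ⟨⟨by simpa [setCell_of_ne] using h1, h1'⟩, by simpa [setCell_of_ne] using h3,
      by simpa [setCell_of_ne] using h4, by simpa [setCell_of_ne] using h5,
      by simpa [setCell_of_ne] using h6, h9⟩
  · intro m hm
    exact hoare_appendFeature N₀ R₀ hj hi (by omega)

/-- Invariant of the loop over the coordinates. -/
def CoordinateInv (i : ℕ) : Assertion := fun n r =>
  FeatureFrame N₀ R₀ n r ∧ HasLevel (n 1) (n 2) (r 4) i (memoryLevel N₀ R₀ i)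

/-- Resetting the length of level `i + 1` suffices to discard what an earlier round left in the
arrays. Each of the entries of level `i` has at most `M + 1` extensions, so `W` controls the work.
-/
theorem hoare_coordinate {N i W : ℕ} (hi : i + 1 < N)
    (hlen : (memoryLevel N₀ R₀ (i + 1)).length < N)
    (hW : (memoryLevel N₀ R₀ i).length * (N₀ 1 0 + 1) ≤ W) :
    Hoare N (fun n r => CoordinateInv N₀ R₀ i n r ∧ n 3 0 0 = i)
      (.seq (.setNat 2 (.add (counter 3) (.const 1)) (.const 0) (.const 0))
        (.loop 4 (.load 2 (counter 3) (.const 0))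
          (.seq startFeature
            (.loop 5 (.add (.load 1 (counter 3) (counter 4)) (.const 1)) appendFeature))))
      (200 * W + 60) (CoordinateInv N₀ R₀ (i + 1)) := by
  have hN : 0 < N := by omega
  have hloop := Hoare.loop (N := N) (a := 4) (b := .load 2 (counter 3) (.const 0))
    (p := .seq startFeature
      (.loop 5 (.add (.load 1 (counter 3) (counter 4)) (.const 1)) appendFeature))
    (K := (memoryLevel N₀ R₀ i).length) (T := 80 * (N₀ 1 0 + 1) + (N₀ 1 0 + 1) + 100)
    (EntryInv N₀ R₀ i) hN (by norm_num) ?_ ?_ ?_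
  · have hstart : Hoare N (fun n r => CoordinateInv N₀ R₀ i n r ∧ n 3 0 0 = i)
        (.setNat 2 (.add (counter 3) (.const 1)) (.const 0) (.const 0)) 40
        (EntryInv N₀ R₀ i 0) := by
      refine Hoare.setNat (T := 40) (by norm_num) (by decide) ?_
      rintro c ⟨⟨⟨hn0, hr0⟩, hl⟩, h3⟩
      refine ⟨by simpa [NatExpr.eval, counter, h3] using hi, hN,
        ⟨by simpa [setCell_of_ne] using hn0, hr0⟩, by simpa [setCell_of_ne] using h3, ?_, ?_⟩
      · refine hl.congr ?_ ?_ rfl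
        · simp [setCell_of_ne]
        · rw [setCell_same, updCell_row_of_ne]
          simp [NatExpr.eval, counter, h3]
      · simpa using HasLevel.nil (by
          simp [setCell_same, NatExpr.eval, counter, h3, updCell_same])
    refine (hstart.seq hloop).mono (fun _ _ h => h) ?_ ?_
    · rintro n r ⟨h1, _, _, h4⟩
      rw [List.take_length] at h4
      exact ⟨h1, h4⟩
    · simp only [NatExpr.cost, counter]
      nlinarith
  · rintro c ⟨_, h3, h4, _⟩
    simpa [NatExpr.eval, counter, h3] using h4.1
  · rintro m _ n r ⟨⟨h1, h1'⟩, h3, h4, h5⟩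
    exact ⟨⟨by simpa [setCell_of_ne] using h1, h1'⟩, by simpa [setCell_of_ne] using h3,
      by simpa [setCell_of_ne] using h4, by simpa [setCell_of_ne] using h5⟩
  · intro m hm
    exact hoare_entry N₀ R₀ hm hi hlen

theorem hoare_computeFeatures {N W : ℕ} (hd : N₀ 0 0 + 1 < N)
    (hW : (N₀ 1 0 + 1) ^ N₀ 0 0 ≤ W) (hWN : W < N) :
    Hoare N (FeatureFrame N₀ R₀) computeFeatures (N₀ 0 0 * (200 * W + 61) + 150)
      (CoordinateInv N₀ R₀ (N₀ 0 0)) := by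
  have hN : 0 < N := by omega
  have hpow : ∀ i ≤ N₀ 0 0, (memoryLevel N₀ R₀ i).length ≤ W := fun i hi =>
    (length_featureLevel_le _ _ _ _).trans ((Nat.pow_le_pow_right (by omega) hi).trans hW)
  have hloop := Hoare.loop (N := N) (a := 3) (b := .load 0 (.const 0) (.const 0))
    (p := .seq (.setNat 2 (.add (counter 3) (.const 1)) (.const 0) (.const 0))
        (.loop 4 (.load 2 (counter 3) (.const 0))
          (.seq startFeature
            (.loop 5 (.add (.load 1 (counter 3) (counter 4)) (.const 1)) appendFeature))))
    (K := N₀ 0 0) (T := 200 * W + 60) (CoordinateInv N₀ R₀) hN (by norm_num) ?_ ?_ ?_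
  · have h1 : Hoare N (FeatureFrame N₀ R₀)
        (.setNat 1 (.const 0) (.const 0) (.load 0 (.const 1) (.const 0))) 40
        (fun n r => FeatureFrame N₀ R₀ n r ∧ n 1 0 0 = N₀ 1 0) := by
      refine Hoare.setNat (T := 40) (by norm_num) (by decide) ?_
      rintro c ⟨hn, hr⟩
      refine ⟨hN, hN, ⟨by simpa [setCell_of_ne] using hn, hr⟩, ?_⟩
      simp [setCell_same, updCell_same, NatExpr.eval, hn]
    have h2 : Hoare N (fun n r => FeatureFrame N₀ R₀ n r ∧ n 1 0 0 = N₀ 1 0)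
        (.setReal 4 (.const 0) (.const 0) (.ofNat (.const 1))) 40
        (fun n r => FeatureFrame N₀ R₀ n r ∧ n 1 0 0 = N₀ 1 0 ∧ r 4 0 0 = 1) := by
      refine Hoare.setReal (T := 40) (by norm_num) (by decide) ?_
      rintro c ⟨⟨hn, hr⟩, h1⟩
      refine ⟨hN, hN, ⟨hn, fun a ha ha' => ?_⟩, h1, ?_⟩
      · rw [setCell_of_ne _ _ _ _ ha]
        exact hr a ha ha'
      · simp [setCell_same, updCell_same, NatExpr.eval, RealExpr.eval]
    have h3 : Hoare N (fun n r => FeatureFrame N₀ R₀ n r ∧ n 1 0 0 = N₀ 1 0 ∧ r 4 0 0 = 1)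
        (.setNat 2 (.const 0) (.const 0) (.const 1)) 40 (CoordinateInv N₀ R₀ 0) := by
      refine Hoare.setNat (T := 40) (by norm_num) (by decide) ?_
      rintro c ⟨⟨hn, hr⟩, h1, h4⟩
      refine ⟨hN, hN, ⟨by simpa [setCell_of_ne] using hn, hr⟩, ?_, fun j hj => ?_⟩
      · simp [setCell_same, updCell_same, NatExpr.eval, memoryLevel, featureLevel]
      · obtain rfl : j = 0 := by simpa [memoryLevel, featureLevel] using hj
        simp [setCell_of_ne, memoryLevel, featureLevel, h1, h4]
    refine (h1.seq (h2.seq (h3.seq hloop))).mono (fun _ _ h => h) (fun _ _ h => h) ?_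
    simp only [NatExpr.cost]
    nlinarith
  · rintro c ⟨⟨h, _⟩, _⟩
    simp [NatExpr.eval, h]
  · rintro m _ n r ⟨⟨h1, h1'⟩, h2⟩
    exact ⟨⟨by simpa [setCell_of_ne] using h1, h1'⟩, by simpa [setCell_of_ne] using h2⟩
  · intro i hi
    refine hoare_coordinate N₀ R₀ (by omega) (lt_of_le_of_lt (hpow _ hi) hWN) ?_
    refine (Nat.mul_le_mul_right _ (length_featureLevel_le _ _ _ _)).trans ?_
    rw [← pow_succ]
    exact (Nat.pow_le_pow_right (by omega) hi).trans hW

end FeatureProgram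

/-! ### Verification of the prediction and of the rank-one update. -/

section ForecastProgram

/-- The number of features. -/
def numFeatures : NatExpr := .load 2 (counter 0) (.const 0)

/-- The feature with index `i`. -/
def feature (i : NatExpr) : RealExpr := .load 4 (counter 0) i

/-- One step in the computation of an entry of the gain vector. -/
def gainStep : Cmd :=
  .setReal 7 (counter 3) (.const 0) (.add (.load 7 (counter 3) (.const 0))
    (.mul (.load 5 (counter 3) (counter 4)) (feature (counter 4))))

/-- Compute an entry of the gain vector and its contributions to the leverage and to the
prediction. -/
def gainEntry : Cmd :=
  .seq (.setReal 7 (counter 3) (.const 0)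
      (.div (feature (counter 3)) (.load 0 (.const 1) (.const 0))))
    (.seq (.loop 4 numFeatures gainStep)
      (.seq (.setReal 8 (.const 0) (.const 0)
          (.add (scalar 8) (.mul (feature (counter 3)) (.load 7 (counter 3) (.const 0)))))
        (.setReal 10 (.const 0) (.const 0)
          (.add (scalar 10) (.mul (.load 7 (counter 3) (.const 0))
            (.load 6 (counter 3) (.const 0)))))))

/-- Compute the prediction from the features. The gain vector is kept in the real array `7`, one
plus the leverage in the real array `8`. -/
def computePrediction : Cmd :=
  .seq (.setReal 8 (.const 0) (.const 0) (.ofNat (.const 1)))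
    (.seq (.setReal 10 (.const 0) (.const 0) (.ofNat (.const 0)))
      (.seq (.loop 3 numFeatures gainEntry)
        (.setReal 3 (.const 0) (.const 0) (.div (scalar 10) (scalar 8)))))

/-- Update an entry of the matrix. -/
def matrixStep : Cmd :=
  .setReal 5 (counter 3) (counter 4) (.sub (.load 5 (counter 3) (counter 4))
    (.div (.mul (.load 7 (counter 3) (.const 0)) (.load 7 (counter 4) (.const 0))) (scalar 8)))

/-- Update a row of the matrix and an entry of the moment vector. -/
def updateRow : Cmd :=
  .seq (.loop 4 numFeatures matrixStep)
    (.setReal 6 (counter 3) (.const 0) (.add (.load 6 (counter 3) (.const 0))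
      (.mul (scalar 2) (feature (counter 3)))))

/-- The online program for the forecaster. The real array `5` holds the difference between the
inverse regularised Gram matrix and its initial value, the real array `6` the moment vector. -/
def forecastProgram : Program where
  init := .setReal 3 (.const 0) (.const 0) (.ofNat (.const 0))
  predict := .seq computeFeatures computePrediction
  update := .loop 3 numFeatures updateRow

variable (N₁ : ℕ → ℕ → ℕ → ℕ) (R₁ : ℕ → ℕ → ℕ → ℝ) (D : ℕ)

/-- The features in memory. -/
def memFeature (j : ℕ) : ℝ := R₁ 4 (N₁ 0 0 0) j

/-- The entries of the gain vector, in terms of the memory before its computation. -/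
noncomputable def memGain (k : ℕ) : ℝ :=
  memFeature N₁ R₁ k / R₁ 0 1 0 + ∑ j ∈ Finset.range D, R₁ 5 k j * memFeature N₁ R₁ j

/-- The memory is unchanged, except for the arrays used in the computation of the prediction. -/
def PredictFrame (n : ℕ → ℕ → ℕ → ℕ) (r : ℕ → ℕ → ℕ → ℝ) : Prop :=
  n 0 = N₁ 0 ∧ n 2 = N₁ 2 ∧ ∀ a, a ≠ 3 → a ≠ 7 → a ≠ 8 → a ≠ 10 → r a = R₁ a

/-- The gain vector is known up to index `i`. -/
def GainInv (i : ℕ) : Assertion := fun n r =>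
  PredictFrame N₁ R₁ n r ∧ (∀ k < i, r 7 k 0 = memGain N₁ R₁ D k) ∧
    r 8 0 0 = 1 + ∑ k ∈ Finset.range i, memFeature N₁ R₁ k * memGain N₁ R₁ D k ∧
    r 10 0 0 = ∑ k ∈ Finset.range i, memGain N₁ R₁ D k * R₁ 6 k 0

/-- The gain vector is known up to index `i` and its entry `i` is partially computed. -/
def GainStepInv (i j : ℕ) : Assertion := fun n r =>
  GainInv N₁ R₁ D i n r ∧ n 3 0 0 = i ∧
    r 7 i 0 = memFeature N₁ R₁ i / R₁ 0 1 0 +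
      ∑ l ∈ Finset.range j, R₁ 5 i l * memFeature N₁ R₁ l

variable {N₁ R₁ D}

theorem GainInv.setReal_gain {i : ℕ} {n : ℕ → ℕ → ℕ → ℕ} {r : ℕ → ℕ → ℕ → ℝ}
    (h : GainInv N₁ R₁ D i n r) (v : ℝ) : GainInv N₁ R₁ D i n (setCell r 7 i 0 v) := by
  obtain ⟨⟨h0, h2, hr⟩, h7, h8, h10⟩ := h
  refine ⟨⟨h0, h2, fun a h3 h7' h8' h10' => ?_⟩, fun k hk => ?_, ?_, ?_⟩
  · rw [setCell_of_ne _ _ _ _ h7']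
    exact hr a h3 h7' h8' h10'
  · rw [setCell_same, updCell_of_ne _ _ (by omega)]
    exact h7 k hk
  · rw [setCell_of_ne _ _ _ _ (by decide), h8]
  · rw [setCell_of_ne _ _ _ _ (by decide), h10]

theorem hoare_gainStep {N i j : ℕ} (hi : i < N) (hN : 0 < N) :
    Hoare N (fun n r => GainStepInv N₁ R₁ D i j n r ∧ n 4 0 0 = j) gainStep 40
      (GainStepInv N₁ R₁ D i (j + 1)) := by
  refine Hoare.setReal (by norm_num) (by decide) ?_
  rintro c ⟨⟨hinv, h3, h7⟩, h4⟩
  have hi' : (counter 3).eval c = i := by simpa [counter, NatExpr.eval] using h3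
  rw [hi']
  refine ⟨hi, hN, hinv.setReal_gain _, h3, ?_⟩
  obtain ⟨⟨h0, h2, hr⟩, -⟩ := hinv
  rw [NatExpr.eval, setCell_same, updCell_same, Finset.sum_range_succ, ← add_assoc, ← h7]
  simp [RealExpr.eval, NatExpr.eval, counter, feature, memFeature, h3, h4, h0,
    hr 5 (by decide) (by decide) (by decide) (by decide),
    hr 4 (by decide) (by decide) (by decide) (by decide)]

theorem eval_numFeatures (hD : N₁ 2 (N₁ 0 0 0) 0 = D) {c : Config} (h0 : c.nat 0 = N₁ 0)
    (h2 : c.nat 2 = N₁ 2) : numFeatures.eval c = D := by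
  simpa [numFeatures, NatExpr.eval, counter, h0, h2] using hD

theorem hoare_gainEntry (hD : N₁ 2 (N₁ 0 0 0) 0 = D) {N i : ℕ} (hi : i < N) :
    Hoare N (fun n r => GainInv N₁ R₁ D i n r ∧ n 3 0 0 = i) gainEntry (41 * D + 150)
      (GainInv N₁ R₁ D (i + 1)) := by
  have hN : 0 < N := by omega
  have h1 : Hoare N (fun n r => GainInv N₁ R₁ D i n r ∧ n 3 0 0 = i)
      (.setReal 7 (counter 3) (.const 0)
        (.div (feature (counter 3)) (.load 0 (.const 1) (.const 0)))) 40
      (GainStepInv N₁ R₁ D i 0) := by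
    refine Hoare.setReal (by norm_num) (by decide) ?_
    rintro c ⟨hinv, h3⟩
    have hi' : (counter 3).eval c = i := by simpa [counter, NatExpr.eval] using h3
    rw [hi']
    refine ⟨hi, hN, hinv.setReal_gain _, h3, ?_⟩
    obtain ⟨⟨h0, h2, hr⟩, -⟩ := hinv
    rw [NatExpr.eval, setCell_same, updCell_same]
    simp [RealExpr.eval, NatExpr.eval, counter, feature, memFeature, h3, h0,
      hr 0 (by decide) (by decide) (by decide) (by decide),
      hr 4 (by decide) (by decide) (by decide) (by decide)]
  have h2 := Hoare.loop (N := N) (a := 4) (b := numFeatures) (p := gainStep) (K := D) (T := 40)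
    (GainStepInv N₁ R₁ D i) hN (by norm_num)
    (fun c ⟨⟨⟨h0, h2, _⟩, _⟩, _⟩ => eval_numFeatures hD h0 h2)
    (fun m _ n r ⟨⟨⟨h0, h2, hr⟩, h7, h8⟩, h3, h7'⟩ =>
      ⟨⟨⟨by simpa [setCell_of_ne] using h0, by simpa [setCell_of_ne] using h2, hr⟩, h7, h8⟩,
        by simpa [setCell_of_ne] using h3, h7'⟩)
    (fun m _ => hoare_gainStep hi hN)
  have h3 : Hoare N (GainStepInv N₁ R₁ D i D)
      (.setReal 8 (.const 0) (.const 0)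
        (.add (scalar 8) (.mul (feature (counter 3)) (.load 7 (counter 3) (.const 0))))) 40
      (fun n r => PredictFrame N₁ R₁ n r ∧ n 3 0 0 = i ∧
        (∀ k < i + 1, r 7 k 0 = memGain N₁ R₁ D k) ∧
        r 8 0 0 = 1 + ∑ k ∈ Finset.range (i + 1), memFeature N₁ R₁ k * memGain N₁ R₁ D k ∧
        r 10 0 0 = ∑ k ∈ Finset.range i, memGain N₁ R₁ D k * R₁ 6 k 0) := by
    refine Hoare.setReal (by norm_num) (by decide) ?_
    rintro c ⟨⟨⟨h0, h2, hr⟩, h7, h8, h10⟩, h3, h7'⟩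
    refine ⟨hN, hN, ⟨h0, h2, fun a ha3 ha7 ha8 ha10 => ?_⟩, h3, fun k hk => ?_, ?_, ?_⟩
    · rw [setCell_of_ne _ _ _ _ ha8]
      exact hr a ha3 ha7 ha8 ha10
    · rw [setCell_of_ne _ _ _ _ (by decide)]
      rcases Nat.lt_succ_iff_lt_or_eq.1 hk with hk | rfl
      · exact h7 k hk
      · exact h7'
    · rw [Finset.sum_range_succ, ← add_assoc, ← h8, memGain, ← h7']
      simp [setCell_same, updCell_same, RealExpr.eval, NatExpr.eval, counter, scalar, feature,
        memFeature, h3, h0, hr 4 (by decide) (by decide) (by decide) (by decide)]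
    · rw [setCell_of_ne _ _ _ _ (by decide), h10]
  have h4 : Hoare N (fun n r => PredictFrame N₁ R₁ n r ∧ n 3 0 0 = i ∧
        (∀ k < i + 1, r 7 k 0 = memGain N₁ R₁ D k) ∧
        r 8 0 0 = 1 + ∑ k ∈ Finset.range (i + 1), memFeature N₁ R₁ k * memGain N₁ R₁ D k ∧
        r 10 0 0 = ∑ k ∈ Finset.range i, memGain N₁ R₁ D k * R₁ 6 k 0)
      (.setReal 10 (.const 0) (.const 0)
        (.add (scalar 10) (.mul (.load 7 (counter 3) (.const 0))
          (.load 6 (counter 3) (.const 0))))) 40 (GainInv N₁ R₁ D (i + 1)) := by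
    refine Hoare.setReal (by norm_num) (by decide) ?_
    rintro c ⟨⟨h0, h2, hr⟩, h3, h7, h8, h10⟩
    refine ⟨hN, hN, ⟨h0, h2, fun a ha3 ha7 ha8 ha10 => ?_⟩, ?_, ?_, ?_⟩
    · rw [setCell_of_ne _ _ _ _ ha10]
      exact hr a ha3 ha7 ha8 ha10
    · rw [setCell_of_ne _ _ _ _ (by decide)]
      exact h7
    · rw [setCell_of_ne _ _ _ _ (by decide), h8]
    · rw [Finset.sum_range_succ, ← h10, ← h7 i (Nat.lt_succ_self i)]
      simp [setCell_same, updCell_same, RealExpr.eval, NatExpr.eval, counter, scalar,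
        h3, hr 6 (by decide) (by decide) (by decide) (by decide)]
  refine (h1.seq (h2.seq (h3.seq h4))).mono (fun _ _ h => h) (fun _ _ h => h) ?_
  simp only [numFeatures, counter, NatExpr.cost]
  omega

/-- The postcondition retains the gain vector and the denominator besides the prediction, because
the update after the output is revealed reuses both. -/
theorem hoare_computePrediction (hD : N₁ 2 (N₁ 0 0 0) 0 = D) {N : ℕ} (hN : D < N) :
    Hoare N (fun n r => n = N₁ ∧ r = R₁) computePrediction (D * (41 * D + 150 + 1) + 150)
      (fun n r => PredictFrame N₁ R₁ n r ∧ (∀ k < D, r 7 k 0 = memGain N₁ R₁ D k) ∧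
        r 8 0 0 = 1 + ∑ k ∈ Finset.range D, memFeature N₁ R₁ k * memGain N₁ R₁ D k ∧
        r 3 0 0 = (∑ k ∈ Finset.range D, memGain N₁ R₁ D k * R₁ 6 k 0) /
          (1 + ∑ k ∈ Finset.range D, memFeature N₁ R₁ k * memGain N₁ R₁ D k)) := by
  have hN0 : 0 < N := by omega
  have h1 : Hoare N (fun n r => n = N₁ ∧ r = R₁)
      (.setReal 8 (.const 0) (.const 0) (.ofNat (.const 1))) 40
      (fun n r => PredictFrame N₁ R₁ n r ∧ r 8 0 0 = 1) := by
    refine Hoare.setReal (by norm_num) (by decide) ?_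
    rintro c ⟨rfl, rfl⟩
    refine ⟨hN0, hN0, ⟨rfl, rfl, fun a _ _ h8 _ => setCell_of_ne _ _ _ _ h8⟩, ?_⟩
    simp [setCell_same, updCell_same, NatExpr.eval, RealExpr.eval]
  have h2 : Hoare N (fun n r => PredictFrame N₁ R₁ n r ∧ r 8 0 0 = 1)
      (.setReal 10 (.const 0) (.const 0) (.ofNat (.const 0))) 40 (GainInv N₁ R₁ D 0) := by
    refine Hoare.setReal (by norm_num) (by decide) ?_
    rintro c ⟨⟨h0, h2, hr⟩, h8⟩
    refine ⟨hN0, hN0, ⟨h0, h2, fun a ha3 ha7 ha8 ha10 => ?_⟩, fun k hk => by omega, ?_, ?_⟩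
    · rw [setCell_of_ne _ _ _ _ ha10]
      exact hr a ha3 ha7 ha8 ha10
    · simpa [setCell_of_ne] using h8
    · simp [setCell_same, updCell_same, NatExpr.eval, RealExpr.eval]
  have h3 := Hoare.loop (N := N) (a := 3) (b := numFeatures) (p := gainEntry) (K := D)
    (T := 41 * D + 150) (GainInv N₁ R₁ D) hN0 (by norm_num)
    (fun c ⟨⟨h0, h2, _⟩, _⟩ => eval_numFeatures hD h0 h2)
    (fun m _ n r ⟨⟨h0, h2, hr⟩, h7, h8⟩ =>
      ⟨⟨by simpa [setCell_of_ne] using h0, by simpa [setCell_of_ne] using h2, hr⟩, h7, h8⟩)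
    (fun m hm => hoare_gainEntry hD (by omega))
  have h4 : Hoare N (GainInv N₁ R₁ D D)
      (.setReal 3 (.const 0) (.const 0) (.div (scalar 10) (scalar 8))) 40
      (fun n r => PredictFrame N₁ R₁ n r ∧ (∀ k < D, r 7 k 0 = memGain N₁ R₁ D k) ∧
        r 8 0 0 = 1 + ∑ k ∈ Finset.range D, memFeature N₁ R₁ k * memGain N₁ R₁ D k ∧
        r 3 0 0 = (∑ k ∈ Finset.range D, memGain N₁ R₁ D k * R₁ 6 k 0) /
          (1 + ∑ k ∈ Finset.range D, memFeature N₁ R₁ k * memGain N₁ R₁ D k)) := by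
    refine Hoare.setReal (by norm_num) (by decide) ?_
    rintro c ⟨⟨h0, h2, hr⟩, h7, h8, h10⟩
    refine ⟨hN0, hN0, ⟨h0, h2, fun a ha3 ha7 ha8 ha10 => ?_⟩, ?_, ?_, ?_⟩
    · rw [setCell_of_ne _ _ _ _ ha3]
      exact hr a ha3 ha7 ha8 ha10
    · rw [setCell_of_ne _ _ _ _ (by decide)]
      exact h7
    · rw [setCell_of_ne _ _ _ _ (by decide), h8]
    · rw [← h8, ← h10]
      simp [setCell_same, updCell_same, NatExpr.eval, RealExpr.eval, scalar]
  refine (h1.seq (h2.seq (h3.seq h4))).mono (fun _ _ h => h) (fun _ _ h => h) ?_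
  simp only [numFeatures, counter, NatExpr.cost]
  omega

variable (N₁ R₁ D)

/-- The memory is unchanged, except for the arrays changed by the update. -/
def UpdateFrame (n : ℕ → ℕ → ℕ → ℕ) (r : ℕ → ℕ → ℕ → ℝ) : Prop :=
  n 0 = N₁ 0 ∧ n 2 = N₁ 2 ∧ ∀ a, a ≠ 5 → a ≠ 6 → r a = R₁ a

/-- The matrix after its update. -/
noncomputable def memMatrix (k l : ℕ) : ℝ := R₁ 5 k l - R₁ 7 k 0 * R₁ 7 l 0 / R₁ 8 0 0

/-- The moment vector after its update. -/
noncomputable def memMoment (k : ℕ) : ℝ := R₁ 6 k 0 + R₁ 2 0 0 * memFeature N₁ R₁ k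

/-- The update is done up to row `i` and, in this row, up to column `j`. -/
def UpdateInv (i j : ℕ) : Assertion := fun n r =>
  UpdateFrame N₁ R₁ n r ∧
    (∀ k l, r 5 k l = if (k < i ∧ l < D) ∨ (k = i ∧ l < j) then memMatrix R₁ k l else R₁ 5 k l) ∧
    ∀ k, r 6 k 0 = if k < i then memMoment N₁ R₁ k else R₁ 6 k 0

variable {N₁ R₁ D}

/-- Updating in place is sound: the correction reads arrays `7` and `8`, which the update never
writes, and the only matrix entry read is the one being replaced. -/
theorem hoare_matrixStep {N i j : ℕ} (hi : i < N) (hj : j < N) :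
    Hoare N (fun n r => (UpdateInv N₁ R₁ D i j n r ∧ n 3 0 0 = i) ∧ n 4 0 0 = j) matrixStep 40
      (fun n r => UpdateInv N₁ R₁ D i (j + 1) n r ∧ n 3 0 0 = i) := by
  refine Hoare.setReal (by norm_num) (by decide) ?_
  rintro c ⟨⟨⟨⟨h0, h2, hr⟩, h5, h6⟩, h3⟩, h4⟩
  have hi' : (counter 3).eval c = i := by simpa [counter, NatExpr.eval] using h3
  have hj' : (counter 4).eval c = j := by simpa [counter, NatExpr.eval] using h4
  have h5ij : c.real 5 i j = R₁ 5 i j := by rw [h5, if_neg (by omega)]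
  rw [hi', hj']
  refine ⟨hi, hj, ⟨⟨h0, h2, fun a ha5 ha6 => ?_⟩, fun k l => ?_, fun k => ?_⟩, h3⟩
  · rw [setCell_of_ne _ _ _ _ ha5]
    exact hr a ha5 ha6
  · rw [setCell_same]
    by_cases hkl : k = i ∧ l = j
    · obtain ⟨rfl, rfl⟩ := hkl
      rw [updCell_same, if_pos (by omega)]
      simp [RealExpr.eval, NatExpr.eval, hi', hj', memMatrix, scalar, h5ij,
        hr 7 (by decide) (by decide), hr 8 (by decide) (by decide)]
    · rw [updCell_of_ne _ _ hkl, h5]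
      refine if_congr ?_ rfl rfl
      omega
  · rw [setCell_of_ne _ _ _ _ (by decide)]
    exact h6 k

theorem hoare_updateRow (hD : N₁ 2 (N₁ 0 0 0) 0 = D) {N i : ℕ} (hi : i < D) (hN : D < N) :
    Hoare N (fun n r => UpdateInv N₁ R₁ D i 0 n r ∧ n 3 0 0 = i) updateRow (41 * D + 50)
      (UpdateInv N₁ R₁ D (i + 1) 0) := by
  have h1 := Hoare.loop (N := N) (a := 4) (b := numFeatures) (p := matrixStep) (K := D) (T := 40)
    (fun j n r => UpdateInv N₁ R₁ D i j n r ∧ n 3 0 0 = i) (by omega) (by norm_num)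
    (fun c ⟨⟨⟨h0, h2, _⟩, _⟩, _⟩ => eval_numFeatures hD h0 h2)
    (fun m _ n r ⟨⟨⟨h0, h2, hr⟩, h5⟩, h3⟩ =>
      ⟨⟨⟨by simpa [setCell_of_ne] using h0, by simpa [setCell_of_ne] using h2, hr⟩, h5⟩,
        by simpa [setCell_of_ne] using h3⟩)
    (fun m hm => hoare_matrixStep (by omega) (by omega))
  have h2 : Hoare N (fun n r => UpdateInv N₁ R₁ D i D n r ∧ n 3 0 0 = i)
      (.setReal 6 (counter 3) (.const 0) (.add (.load 6 (counter 3) (.const 0))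
        (.mul (scalar 2) (feature (counter 3))))) 40 (UpdateInv N₁ R₁ D (i + 1) 0) := by
    refine Hoare.setReal (by norm_num) (by decide) ?_
    rintro c ⟨⟨⟨h0, h2, hr⟩, h5, h6⟩, h3⟩
    have hi' : (counter 3).eval c = i := by simpa [counter, NatExpr.eval] using h3
    have h6i : c.real 6 i 0 = R₁ 6 i 0 := by rw [h6, if_neg (lt_irrefl _)]
    rw [hi']
    refine ⟨by omega, by simp only [NatExpr.eval]; omega,
      ⟨h0, h2, fun a ha5 ha6 => ?_⟩, fun k l => ?_, fun k => ?_⟩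
    · rw [setCell_of_ne _ _ _ _ ha6]
      exact hr a ha5 ha6
    · rw [setCell_of_ne _ _ _ _ (by decide), h5]
      refine if_congr ?_ rfl rfl
      omega
    · rw [setCell_same, NatExpr.eval]
      by_cases hk : k = i
      · subst hk
        rw [updCell_same, if_pos (Nat.lt_succ_self k)]
        simp [RealExpr.eval, NatExpr.eval, memMoment, memFeature, scalar, feature, h6i,
          hr 2 (by decide) (by decide), hr 4 (by decide) (by decide), h0, counter, h3]
      · rw [updCell_of_ne _ _ (by omega), h6]
        refine if_congr ?_ rfl rfl
        omega
  refine (h1.seq h2).mono (fun _ _ h => h) (fun _ _ h => h) ?_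
  simp only [numFeatures, counter, NatExpr.cost]
  omega

theorem hoare_update (hD : N₁ 2 (N₁ 0 0 0) 0 = D) {N : ℕ} (hN : D < N) :
    Hoare N (fun n r => n = N₁ ∧ r = R₁) forecastProgram.update (D * (41 * D + 50 + 1) + 10)
      (UpdateInv N₁ R₁ D D 0) := by
  have h := Hoare.loop (N := N) (a := 3) (b := numFeatures) (p := updateRow) (K := D)
    (T := 41 * D + 50) (fun i => UpdateInv N₁ R₁ D i 0) (by omega) (by norm_num)
    (fun c ⟨⟨h0, h2, _⟩, _⟩ => eval_numFeatures hD h0 h2)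
    (fun m _ n r ⟨⟨h0, h2, hr⟩, h5⟩ =>
      ⟨⟨by simpa [setCell_of_ne] using h0, by simpa [setCell_of_ne] using h2, hr⟩, h5⟩)
    (fun m hm => hoare_updateRow hD hm hN)
  refine h.mono ?_ (fun _ _ h => h) ?_
  · rintro n r ⟨rfl, rfl⟩
    exact ⟨⟨rfl, rfl, fun _ _ _ => rfl⟩, fun k l => by simp, fun k => by simp⟩
  · simp only [numFeatures, counter, NatExpr.cost]
    omega

end ForecastProgram

/-! ### From single commands to complete rounds and total cost. -/

section Rounds

open Matrix

variable {d : ℕ}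

/-- The disjunction "still to be written, or already correct" is what makes the claim about the
input cells inductive over the list. -/
theorem receiveInput_aux (v : EuclideanSpace ℝ (Fin d)) {N : ℕ} (hN : d ≤ N) (l : List (Fin d))
    (c : Config) (hc : c.cells ⊆ cellBox N) :
    let c' := l.foldl (fun c' (i : Fin d) => c'.writeReal 1 i 0 (v i)) c
    c'.nat = c.nat ∧ (∀ a, a ≠ 1 → c'.real a = c.real a) ∧
      (∀ i : Fin d, (i ∈ l ∨ c.real 1 i 0 = v i) → c'.real 1 i 0 = v i) ∧
      c'.time = c.time + l.length ∧ c'.cells ⊆ cellBox N := by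
  induction l generalizing c with
  | nil => exact ⟨rfl, fun _ _ => rfl, by simp, rfl, hc⟩
  | cons i l ih =>
    obtain ⟨h1, h2, h3, h4, h5⟩ := ih (c.writeReal 1 i 0 (v i))
      (insert_subset_cellBox (by norm_num) (i.2.trans_le hN) ((Nat.zero_le _).trans_lt
        (i.2.trans_le hN)) hc)
    refine ⟨h1, fun a ha => ?_, fun j hj => h3 j ?_, ?_, h5⟩
    · rw [List.foldl_cons, h2 a ha, writeReal_real, setCell_of_ne _ _ _ _ ha]
    · rw [writeReal_real, setCell_same]
      by_cases hij : j = i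
      · subst hij
        exact Or.inr (updCell_same _ _ _ _)
      · rw [updCell_of_ne _ _ fun h => hij (Fin.ext h.1)]
        exact hj.imp_left fun h => (List.mem_cons.1 h).resolve_left hij
    · rw [List.foldl_cons, h4, writeReal_time, List.length_cons]
      ring

/-- The order in which the program stores the multi-indices. -/
def storedIndex (M d : ℕ) (i : Fin (multiIndices M d).length) : Fin d → ℕ :=
  (multiIndices M d).get i

theorem storedIndex_injective (M d : ℕ) : Function.Injective (storedIndex M d) :=
  List.nodup_iff_injective_get.1 (nodup_multiIndices M d)

theorem exists_storedIndex_iff {M d : ℕ} {k : Fin d → ℕ} :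
    (∃ i, storedIndex M d i = k) ↔ ∑ i, k i ≤ M := by
  rw [← mem_multiIndices, List.mem_iff_get]
  rfl

/-- The feature vectors of a sequence of inputs, in the order of the program. -/
noncomputable def storedFeature (σ : ℝ) (M : ℕ) (x : ℕ → EuclideanSpace ℝ (Fin d)) (t : ℕ) :
    Fin (multiIndices M d).length → ℝ := fun i => taylorFun σ (storedIndex M d i) (x t)

/-- The content of the memory between two rounds. -/
def RoundInv (M : ℕ) (σ lam : ℝ) (x : ℕ → EuclideanSpace ℝ (Fin d)) (y : ℕ → ℝ) (t : ℕ) :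
    Assertion := fun n r =>
  n 0 0 0 = d ∧ n 0 1 0 = M ∧ r 0 0 0 = σ ∧ r 0 1 0 = lam ∧
    (∀ i j : Fin (multiIndices M d).length,
      r 5 i j = (invGram lam (storedFeature σ M x) t - lam⁻¹ • 1) i j) ∧
    ∀ i : Fin (multiIndices M d).length, r 6 i 0 = moment (storedFeature σ M x) y t i

variable {M : ℕ} {σ lam : ℝ} {x : ℕ → EuclideanSpace ℝ (Fin d)} {y : ℕ → ℝ}

theorem round_time_le {D W : ℕ} (hDW : D ≤ W) (hW : 1 ≤ W) (d : ℕ) :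
    d + (d * (200 * W + 61) + 150) + (D * (41 * D + 150 + 1) + 150) + 1 +
      (D * (41 * D + 50 + 1) + 10) ≤ 1000 * (d + 1) * W ^ 2 := by
  have hWW : W ≤ W ^ 2 := Nat.le_self_pow two_ne_zero W
  have hDD : D * D ≤ W ^ 2 := by
    rw [sq]
    exact Nat.mul_le_mul hDW hDW
  have hdW : d * W ≤ d * W ^ 2 := Nat.mul_le_mul_left _ hWW
  have hd1 : d * 1 ≤ d * W ^ 2 := Nat.mul_le_mul_left _ (hW.trans hWW)
  have e1 : d * (200 * W + 61) = 200 * (d * W) + 61 * d := by ring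
  have e2 : D * (41 * D + 150 + 1) = 41 * (D * D) + 151 * D := by ring
  have e3 : D * (41 * D + 50 + 1) = 41 * (D * D) + 51 * D := by ring
  have e4 : 1000 * (d + 1) * W ^ 2 = 1000 * (d * W ^ 2) + 1000 * W ^ 2 := by ring
  omega

/-- The effect of one round: input, prediction, output, update. -/
theorem round_spec {t N W : ℕ} (hW : (M + 1) ^ d ≤ W) (hWN : W < N) (hd : d + 1 < N) {c : Config}
    (hc : RoundInv M σ lam x y t c.nat c.real) (hcells : c.cells ⊆ cellBox N) (hlam : 0 < lam) :
    (forecastProgram.predict.exec (receiveInput (x t) c)).real 3 0 0 =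
        storedFeature σ M x t ⬝ᵥ forecastWeight lam (storedFeature σ M x) y t ∧
      let c' := forecastProgram.update.exec (receiveOutput (y t)
        (forecastProgram.predict.exec (receiveInput (x t) c)))
      RoundInv M σ lam x y (t + 1) c'.nat c'.real ∧
        c'.time ≤ c.time + 1000 * (d + 1) * W ^ 2 ∧ c'.cells ⊆ cellBox N := by
  set φ := storedFeature σ M x with hφ
  obtain ⟨hnd, hnM, hrσ, hrlam, hr5, hr6⟩ := hc
  obtain ⟨i1, i2, i3, i4, i5⟩ := receiveInput_aux (x t) (N := N) (by omega) (List.finRange d) c hcells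
  set c₀ := receiveInput (x t) c with hc₀
  change c₀.nat = c.nat at i1
  change ∀ a, a ≠ 1 → c₀.real a = c.real a at i2
  change ∀ i : Fin d, (i ∈ List.finRange d ∨ c.real 1 i 0 = x t i) → c₀.real 1 i 0 = x t i at i3
  change c₀.time = c.time + (List.finRange d).length at i4
  change c₀.cells ⊆ cellBox N at i5
  have hN0d : c₀.nat 0 0 0 = d := by rw [i1, hnd]
  have hN0M : c₀.nat 0 1 0 = M := by rw [i1, hnM]
  obtain ⟨f1, f2, f3⟩ := hoare_computeFeatures (c₀.nat 0) c₀.real (N := N) (W := W)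
    (by rw [hN0d]; exact hd) (by rw [hN0d, hN0M]; exact hW) hWN c₀ ⟨rfl, fun _ _ _ => rfl⟩ i5
  set c₁ := computeFeatures.exec c₀ with hc₁
  rw [hN0d] at f1 f2
  obtain ⟨⟨g0, gr⟩, glen, gval⟩ := f1
  have hlevel : memoryLevel (c₀.nat 0) c₀.real d =
      (multiIndices M d).map fun k => (M - ∑ j, k j, taylorFun σ k (x t)) := by
    rw [memoryLevel, featureLevel_eq_map, hN0M]
    refine List.map_congr_left fun k _ => ?_
    rw [taylorFun, i2 0 (by decide), hrσ]
    simp only [i3 _ (Or.inl (List.mem_finRange _))]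
  have hlen : (memoryLevel (c₀.nat 0) c₀.real d).length = (multiIndices M d).length := by rw [hlevel, List.length_map]
  have hDW : (multiIndices M d).length ≤ W := by
    have := length_featureLevel_le σ (fun _ => 0) M d
    rw [length_featureLevel] at this
    exact this.trans hW
  have h1d : c₁.nat 0 0 0 = d := by rw [g0, hN0d]
  have hD : c₁.nat 2 (c₁.nat 0 0 0) 0 = (multiIndices M d).length := by rw [h1d, glen, hlen]
  have hfeat : ∀ i : Fin (multiIndices M d).length, memFeature c₁.nat c₁.real i = φ t i := by
    intro i
    have hi : (i : ℕ) < (memoryLevel (c₀.nat 0) c₀.real d).length := by rw [hlen]; exact i.2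
    rw [memFeature, h1d, (gval i hi).2]
    simp only [hlevel, List.getElem_map]
    rfl
  have h15 : ∀ i j : Fin (multiIndices M d).length, c₁.real 5 i j = (invGram lam φ t - lam⁻¹ • 1) i j := by
    intro i j
    rw [gr 5 (by decide) (by decide), i2 5 (by decide), hr5]
  have h16 : ∀ i : Fin (multiIndices M d).length, c₁.real 6 i 0 = moment φ y t i := by
    intro i
    rw [gr 6 (by decide) (by decide), i2 6 (by decide), hr6]
  have h1lam : c₁.real 0 1 0 = lam := by
    rw [gr 0 (by decide) (by decide), i2 0 (by decide), hrlam]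
  -- The summand `φ_k / λ` of the gain restores the part `λ⁻¹ I` that array `5` omits.
  have hgain : ∀ k : Fin (multiIndices M d).length, memGain c₁.nat c₁.real (multiIndices M d).length k = (invGram lam φ t *ᵥ φ t) k := by
    intro k
    rw [memGain, Finset.sum_range]
    simp only [hfeat, h15, h1lam]
    simp [Matrix.mulVec, dotProduct, sub_mul, Finset.sum_sub_distrib, Matrix.one_apply]
    ring
  have hlev : 1 + ∑ k ∈ Finset.range (multiIndices M d).length, memFeature c₁.nat c₁.real k * memGain c₁.nat c₁.real (multiIndices M d).length k =
      1 + leverage lam φ t := by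
    rw [Finset.sum_range, leverage, dotProduct]
    simp only [hfeat, hgain]
  have hnum : ∑ k ∈ Finset.range (multiIndices M d).length, memGain c₁.nat c₁.real (multiIndices M d).length k * c₁.real 6 k 0 =
      (invGram lam φ t *ᵥ φ t) ⬝ᵥ moment φ y t := by
    rw [Finset.sum_range, dotProduct]
    simp only [h16, hgain]
  obtain ⟨p1, p2, p3⟩ := hoare_computePrediction (N₁ := c₁.nat) (R₁ := c₁.real) hD (N := N)
    (by omega) c₁ ⟨rfl, rfl⟩ f3
  obtain ⟨⟨q0, q2, qr⟩, q7, q8, q3⟩ := p1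
  set c₂ := computePrediction.exec c₁ with hc₂
  have hpred : forecastProgram.predict.exec c₀ = c₂ := rfl
  rw [hlev] at q8
  refine ⟨?_, ?_⟩
  · rw [hpred, q3, hlev, hnum, forecastWeight, dotProduct_invGram_succ hlam]
  rw [hpred]
  set c₃ := receiveOutput (y t) c₂ with hc₃
  have hD3 : c₃.nat 2 (c₃.nat 0 0 0) 0 = (multiIndices M d).length := by
    change c₂.nat 2 (c₂.nat 0 0 0) 0 = (multiIndices M d).length
    rw [q0, q2, hD]
  have hr3 : ∀ a, a ≠ 2 → c₃.real a = c₂.real a := fun a ha => setCell_of_ne _ _ _ _ ha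
  have hr3y : c₃.real 2 0 0 = y t := by
    change setCell c₂.real 2 0 0 (y t) 2 0 0 = y t
    rw [setCell_same, updCell_same]
  obtain ⟨u1, u2, u3⟩ := hoare_update (N₁ := c₃.nat) (R₁ := c₃.real) hD3 (N := N) (by omega) c₃
    ⟨rfl, rfl⟩ (insert_subset_cellBox (by norm_num) (by omega) (by omega) p3)
  have hc₃t : c₃.time = c₂.time + 1 := rfl
  set c₄ := forecastProgram.update.exec c₃ with hc₄
  obtain ⟨⟨v0, v2, vr⟩, v5, v6⟩ := u1
  have hframe : ∀ a, a ≠ 1 → a ≠ 2 → a ≠ 3 → a ≠ 4 → a ≠ 5 → a ≠ 6 → a ≠ 7 → a ≠ 8 → a ≠ 9 →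
      a ≠ 10 → c₄.real a = c.real a := by
    intro a a1 a2 a3 a4 a5 a6 a7 a8 a9 a10
    rw [vr a a5 a6, hr3 a a2, qr a a3 a7 a8 a10, gr a a4 a9, i2 a a1]
  have hn40 : c₄.nat 0 = c.nat 0 := by
    rw [v0]
    change c₂.nat 0 = _
    rw [q0, g0, i1]
  have hfeat3 : ∀ i : Fin (multiIndices M d).length, memFeature c₃.nat c₃.real i = φ t i := by
    intro i
    rw [← hfeat i, memFeature, memFeature, hr3 4 (by decide),
      qr 4 (by decide) (by decide) (by decide) (by decide)]
    change c₁.real 4 (c₂.nat 0 0 0) i = _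
    rw [q0]
  have hr37 : ∀ i : Fin (multiIndices M d).length, c₃.real 7 i 0 = (invGram lam φ t *ᵥ φ t) i := by
    intro i
    rw [hr3 7 (by decide), q7 i i.2, hgain]
  have hr38 : c₃.real 8 0 0 = 1 + leverage lam φ t := by rw [hr3 8 (by decide), q8]
  refine ⟨⟨by rw [hn40, hnd], by rw [hn40, hnM], ?_, ?_, fun i j => ?_, fun i => ?_⟩, ?_, u3⟩
  · rw [hframe 0 (by decide) (by decide) (by decide) (by decide) (by decide) (by decide)
      (by decide) (by decide) (by decide) (by decide), hrσ]
  · rw [hframe 0 (by decide) (by decide) (by decide) (by decide) (by decide) (by decide)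
      (by decide) (by decide) (by decide) (by decide), hrlam]
  · rw [v5, if_pos (Or.inl ⟨i.2, j.2⟩), memMatrix, hr37, hr37, hr38, hr3 5 (by decide),
      qr 5 (by decide) (by decide) (by decide) (by decide), h15, invGram, ← leverage]
    simp only [Matrix.sub_apply, Matrix.smul_apply, vecMulVec_apply, smul_eq_mul]
    ring
  · rw [v6, if_pos i.2, memMoment, hfeat3, hr3y, hr3 6 (by decide),
      qr 6 (by decide) (by decide) (by decide) (by decide), h16, moment_succ]
    rfl
  · rw [List.length_finRange] at i4
    have hW1 : 1 ≤ W := Nat.one_le_iff_ne_zero.2 (by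
      rintro rfl
      exact absurd (Nat.le_zero.1 hW) (by positivity))
    have htime := round_time_le hDW hW1 d
    omega

/-- Since array `5` stores the inverse minus `λ⁻¹ I`, blank memory already represents round `0`.
Initialisation takes constant time and need not know the number of features. -/
theorem init_spec {N : ℕ} (hN : 2 < N) :
    RoundInv M σ lam x y 0 (forecastProgram.after M σ lam x y 0).nat
        (forecastProgram.after M σ lam x y 0).real ∧
      (forecastProgram.after M σ lam x y 0).time ≤ 100 ∧
      (forecastProgram.after M σ lam x y 0).cells ⊆ cellBox N := by
  refine ⟨?_, ?_, ?_⟩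
  · simp [RoundInv, Program.after, forecastProgram, Cmd.exec, loadParams, writeNat_nat,
      writeNat_real, writeReal_nat, writeReal_real, tick_nat, tick_real, setCell, Config.blank,
      invGram, moment]
  · simp [Program.after, forecastProgram, Cmd.exec, loadParams, writeNat_time, writeReal_time,
      tick_time, NatExpr.cost, RealExpr.cost, Config.blank]
  · refine insert_subset_cellBox (by norm_num) (by simp [NatExpr.eval]; omega)
      (by simp [NatExpr.eval]; omega) ?_
    refine insert_subset_cellBox (by norm_num) (by omega) (by omega)
      (insert_subset_cellBox (by norm_num) (by omega) (by omega)
      (insert_subset_cellBox (by norm_num) (by omega) (by omega)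
      (insert_subset_cellBox (by norm_num) (by omega) (by omega) (Finset.empty_subset _))))

/-- The box of cells is the same for all `t`: rounds reuse memory, so the space bound does not grow
with the number of rounds. -/
theorem after_spec {N W : ℕ} (hW : (M + 1) ^ d ≤ W) (hWN : W < N) (hd : d + 1 < N) (hN : 2 < N)
    (hlam : 0 < lam) (t : ℕ) :
    RoundInv M σ lam x y t (forecastProgram.after M σ lam x y t).nat
        (forecastProgram.after M σ lam x y t).real ∧
      (forecastProgram.after M σ lam x y t).cells ⊆ cellBox N := by
  induction t with
  | zero =>
    obtain ⟨h1, _, h2⟩ := init_spec (M := M) (σ := σ) (lam := lam) (x := x) (y := y) hN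
    exact ⟨h1, h2⟩
  | succ t ih =>
    obtain ⟨h1, _, h2⟩ := (round_spec hW hWN hd ih.1 ih.2 hlam).2
    exact ⟨h1, h2⟩

/-- The program issues the predictions of the forecaster with quadratic cost in the number of
features. -/
theorem forecastProgram_runs (hd : 1 ≤ d) (hlam : 0 < lam) (n : ℕ) {b : ℝ}
    (hb : 1000 * ((d : ℝ) + 3) ^ 2 * (((M : ℝ) + 1) ^ d) ^ 2 ≤ b) :
    forecastProgram.Runs M σ lam n x y
      (fun t => storedFeature σ M x t ⬝ᵥ forecastWeight lam (storedFeature σ M x) y t) b := by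
  set W := (M + 1) ^ d with hWdef
  have hW1 : 1 ≤ W := Nat.one_le_pow _ _ (Nat.succ_pos _)
  -- Large enough for levels, coordinates and parameters, yet at most `(d + 3) * W`, so the box has
  -- `O(W²)` cells for fixed `d`.
  set N := W + d + 2 with hNdef
  have hspec := after_spec (M := M) (σ := σ) (x := x) (y := y) (N := N) (W := W) le_rfl
    (by omega) (by omega) (by omega) hlam
  have hW1R : (1 : ℝ) ≤ W := by exact_mod_cast hW1
  have hbW : 1000 * ((d : ℝ) + 3) ^ 2 * (W : ℝ) ^ 2 ≤ b := by
    refine le_trans (le_of_eq ?_) hb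
    rw [hWdef]
    push_cast
    ring
  have hd0 : (0 : ℝ) ≤ d := Nat.cast_nonneg _
  have hWsq : (1 : ℝ) ≤ (W : ℝ) ^ 2 := one_le_pow₀ hW1R
  refine ⟨fun t _ => ?_, ?_, fun t _ => ?_, ?_⟩
  · exact (round_spec le_rfl (by omega) (by omega) (hspec t).1 (hspec t).2 hlam).1
  · have h := (init_spec (M := M) (σ := σ) (lam := lam) (x := x) (y := y) (N := N) (by omega)).2.1
    have h' : ((forecastProgram.after M σ lam x y 0).time : ℝ) ≤ 100 := by exact_mod_cast h
    nlinarith [mul_nonneg (sq_nonneg ((d : ℝ) + 3)) (sub_nonneg.2 hWsq)]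
  · have h := (round_spec (W := W) le_rfl (by omega) (by omega) (hspec t).1 (hspec t).2 hlam).2.2.1
    have h' : ((forecastProgram.after M σ lam x y (t + 1)).time : ℝ) ≤
        (forecastProgram.after M σ lam x y t).time + 1000 * (d + 1) * W ^ 2 := by exact_mod_cast h
    have h2 : 1000 * ((d : ℝ) + 1) * W ^ 2 ≤ 1000 * ((d : ℝ) + 3) ^ 2 * (W : ℝ) ^ 2 := by
      gcongr
      nlinarith
    linarith
  · have h : (forecastProgram.after M σ lam x y n).space ≤ 40 * N ^ 2 := by
      rw [← card_cellBox]
      exact Finset.card_le_card (hspec n).2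
    have h' : ((forecastProgram.after M σ lam x y n).space : ℝ) ≤ 40 * (W + d + 2) ^ 2 := by
      exact_mod_cast h
    have h2 : (W : ℝ) + d + 2 ≤ (d + 3) * W := by nlinarith
    have h3 : ((W : ℝ) + d + 2) ^ 2 ≤ ((d + 3) * W) ^ 2 := pow_le_pow_left₀ (by positivity) h2 2
    rw [mul_pow] at h3
    have h4 : 0 ≤ ((d : ℝ) + 3) ^ 2 * (W : ℝ) ^ 2 := by positivity
    linarith

end Rounds

/-! ### Approximation by the Taylor span and the size of the Taylor order. -/

section Main

open scoped InnerProductSpace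
open Matrix

variable {d : ℕ} {X : Set (EuclideanSpace ℝ (Fin d))} {H : Type*} [NormedAddCommGroup H]
  [InnerProductSpace ℝ H]

/-- Elements of `H` are determined by their values on `X`, so the generators in `H` are precisely
the `G k`. -/
theorem taylorSpan_eq_span_range [RKHS ℝ H X ℝ] {σ : ℝ} {G : (Fin d → ℕ) → H}
    (hG : ∀ k (x : X), G k x = taylorFun σ k x) (M : ℕ) :
    taylorSpan H σ M = Submodule.span ℝ (Set.range fun i => G (storedIndex M d i)) := by
  rw [taylorSpan]
  congr 1
  ext g
  constructor
  · rintro ⟨k, hk, hg⟩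
    obtain ⟨i, hi⟩ := exists_storedIndex_iff.2 hk
    refine ⟨i, RKHS.ext fun x => ?_⟩
    simp only [hi, hG, hg]
  · rintro ⟨i, rfl⟩
    exact ⟨storedIndex M d i, exists_storedIndex_iff.1 ⟨i, rfl⟩, hG _⟩

variable [CompleteSpace H] [RKHS ℝ H X ℝ]

/-- The expansion of a kernel section along an orthonormal family is its best approximation. -/
theorem norm_kernelSection_sub_le {ι : Type*} [Fintype ι] {e : ι → H} (he : Orthonormal ℝ e)
    (x : X) {v : H} (hv : v ∈ Submodule.span ℝ (Set.range e)) :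
    ‖kernelSection H x - ∑ i, e i x • e i‖ ^ 2 ≤ ‖kernelSection H x - v‖ ^ 2 := by
  classical
  obtain ⟨w, rfl⟩ := (mem_span_range_iff_exists_sum e).1 hv
  have horth : ⟪kernelSection H x - ∑ i, e i x • e i, ∑ i, (e i x - w i) • e i⟫_ℝ = 0 := by
    rw [inner_sub_left, inner_kernelSection, sum_smul_apply, he.inner_sum]
    simp [mul_comm]
  have hsplit : kernelSection H x - ∑ i, w i • e i =
      (kernelSection H x - ∑ i, e i x • e i) + ∑ i, (e i x - w i) • e i := by
    simp only [sub_smul, Finset.sum_sub_distrib]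
    abel
  rw [hsplit, norm_add_sq_real, horth]
  nlinarith [sq_nonneg ‖∑ i, (e i x - w i) • e i‖]

/-- The projection onto the span is at least as close as the truncated Taylor expansion. The basis
`e` is arbitrary, so the Taylor functions themselves need not be orthonormal, and no interior point
is required. -/
theorem kernelSection_approximation {σ R : ℝ} (hσ : 0 < σ) {G : (Fin d → ℕ) → H}
    (happ : ∀ (x : X) (s : Finset (Fin d → ℕ)),
      ‖kernelSection H x - ∑ k ∈ s, taylorFun σ k x • G k‖ ^ 2 ≤
        ∑' k : Fin d → ℕ, (if k ∈ s then 0 else taylorFun σ k x ^ 2))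
    {M : ℕ} (hM : 8 * R ^ 2 / σ ^ 2 ≤ M) {ι : Type*} [Fintype ι] {e : ι → H}
    (he : Orthonormal ℝ e)
    (hspan : Submodule.span ℝ (Set.range e) =
      Submodule.span ℝ (Set.range fun i => G (storedIndex M d i)))
    {x : X} (hx : ‖(x : EuclideanSpace ℝ (Fin d))‖ ≤ R) :
    ‖kernelSection H x - ∑ i, e i x • e i‖ ^ 2 ≤ Real.exp (-M) / 8 := by
  classical
  set s : Finset (Fin d → ℕ) := Finset.univ.image (storedIndex M d) with hs
  have hmem : ∀ k, k ∈ s ↔ ∑ i, k i ≤ M := by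
    intro k
    rw [hs, Finset.mem_image, ← exists_storedIndex_iff]
    simp
  have hv : ∑ k ∈ s, taylorFun σ k x • G k ∈ Submodule.span ℝ (Set.range e) := by
    rw [hspan]
    refine Submodule.sum_mem _ fun k hk => Submodule.smul_mem _ _ (Submodule.subset_span ?_)
    obtain ⟨i, _, rfl⟩ := Finset.mem_image.1 hk
    exact ⟨i, rfl⟩
  refine (norm_kernelSection_sub_le he x hv).trans ((happ x s).trans ?_)
  simp only [hmem]
  exact tsum_taylorFun_sq_tail_le hσ hM hx

/-- The order of the Taylor expansion is at most logarithmic in `n`. -/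
theorem taylorOrder_pow_le (hd : 1 ≤ d) {σ R lam : ℝ} (hlam : 0 < lam) {n : ℕ} (hn : 1 ≤ n) {M : ℕ}
    (hM : M = ⌈max (8 * R ^ 2 / σ ^ 2) (2 * Real.log (n / min lam 1))⌉₊) :
    (((M : ℝ) + 1) ^ d) ^ 2 ≤ (8 * R ^ 2 / σ ^ 2 + 2 + 2 * d) ^ (2 * d) *
      (3 + 1 / (d : ℝ) * Real.log (n / min lam 1)) ^ (2 * d) := by
  have hdR : (0 : ℝ) < d := by exact_mod_cast hd
  have hnR : (1 : ℝ) ≤ n := by exact_mod_cast hn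
  have hL : 0 ≤ Real.log (n / min lam 1) := by
    refine Real.log_nonneg ?_
    rw [one_le_div (lt_min hlam one_pos)]
    exact (min_le_right _ _).trans hnR
  set L := Real.log (n / min lam 1)
  have hs : 0 ≤ 8 * R ^ 2 / σ ^ 2 := by positivity
  set s := 8 * R ^ 2 / σ ^ 2
  have hM1 : (M : ℝ) + 1 ≤ s + 2 * L + 2 := by
    have h1 : (M : ℝ) < max s (2 * L) + 1 := hM ▸ Nat.ceil_lt_add_one (hs.trans (le_max_left _ _))
    have h2 : max s (2 * L) ≤ s + 2 * L := max_le (by linarith) (by linarith)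
    linarith
  -- The summand `2 * d` turns `L / d` back into `2 L`; the rest of the first factor absorbs the
  -- constants.
  have hprod : (M : ℝ) + 1 ≤ (s + 2 + 2 * d) * (3 + 1 / (d : ℝ) * L) := by
    have e : (s + 2 + 2 * d) * (3 + 1 / (d : ℝ) * L) =
        3 * (s + 2 + 2 * d) + (s + 2) * (1 / d * L) + 2 * L := by
      field_simp
      ring
    have h3 : 0 ≤ (s + 2) * (1 / d * L) := by positivity
    rw [e]
    linarith
  rw [← pow_mul, mul_comm d 2, ← mul_pow]
  exact pow_le_pow_left₀ (by positivity) hprod _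

end Main

end PKAWV

theorem mainTheorem1 :
    ∃ P : Program, ∀ d : ℕ, 1 ≤ d → ∀ σ R : ℝ, 0 < σ → 0 < R → ∃ C : ℝ,
      ∀ (X : Set (EuclideanSpace ℝ (Fin d))) (H : Type*) [NormedAddCommGroup H]
        [InnerProductSpace ℝ H] [CompleteSpace H] [RKHS ℝ H X ℝ],
        (∀ u v : X, RKHS.kernel H u v 1 = gaussianKernel σ (u : EuclideanSpace ℝ (Fin d)) v) →
      ∀ (lam B : ℝ) (n : ℕ), 0 < lam → 0 < B → 1 ≤ n →
      ∀ (x : ℕ → X) (y : ℕ → ℝ),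
        (∀ t < n, ‖(x t : EuclideanSpace ℝ (Fin d))‖ ≤ R) → (∀ t < n, |y t| ≤ B) →
      ∀ M : ℕ, M = ⌈max (8 * R ^ 2 / σ ^ 2) (2 * Real.log (n / min lam 1))⌉₊ →
        (∃! fhat : ℕ → H, IsPKAWV (taylorSpan H σ M) lam x y fhat) ∧
        ∀ fhat : ℕ → H, IsPKAWV (taylorSpan H σ M) lam x y fhat →
          (∀ f : H, regret n x y fhat f ≤ lam * ‖f‖ ^ 2 + 3 * B ^ 2 / 2 *
            ∑ j, Real.log (1 + (kernelMatrix_isHermitian σ n x).eigenvalues j / lam)) ∧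
          ((interior X).Nonempty →
            P.Runs M σ lam n (fun t => (x t : EuclideanSpace ℝ (Fin d))) y
              (fun t => fhat t (x t))
              (C * (3 + 1 / (d : ℝ) * Real.log (n / min lam 1)) ^ (2 * d))) := by
  refine ⟨forecastProgram, fun d hd σ R hσ _ =>
    ⟨1000 * ((d : ℝ) + 3) ^ 2 * (8 * R ^ 2 / σ ^ 2 + 2 + 2 * d) ^ (2 * d), ?_⟩⟩
  intro X H _ _ _ _ hk lam B n hlam _ hn x y hx hy M hM
  obtain ⟨G, hG, happ, horth⟩ := exists_taylorElements (H := H) hσ hk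
  have hspan := taylorSpan_eq_span_range hG M
  have hceil : max (8 * R ^ 2 / σ ^ 2) (2 * Real.log (n / min lam 1)) ≤ M := hM ▸ Nat.le_ceil _
  have hfin : FiniteDimensional ℝ (taylorSpan H σ M) := by
    rw [hspan]
    exact FiniteDimensional.span_of_finite ℝ (Set.finite_range _)
  -- Existence and regret hold for every domain. If `X` has no interior point the Taylor functions
  -- can be linearly dependent, so an abstract orthonormal basis of their span replaces them.
  obtain ⟨m, e, he, hespan⟩ : ∃ (m : ℕ) (e : Fin m → H), Orthonormal ℝ e ∧
      Submodule.span ℝ (Set.range e) = taylorSpan H σ M := by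
    let b := stdOrthonormalBasis ℝ (taylorSpan H σ M)
    refine ⟨_, fun i => (b i : H), b.orthonormal.comp_linearIsometry (Submodule.subtypeₗᵢ _), ?_⟩
    have h := congrArg (Submodule.map (taylorSpan H σ M).subtype) b.toBasis.span_eq
    rw [Submodule.map_span, ← Set.range_comp, Submodule.map_subtype_top] at h
    refine Eq.trans (congrArg (fun v => Submodule.span ℝ (Set.range v)) ?_) h
    funext i
    simp
  refine ⟨?_, fun fhat hf => ⟨fun f => ?_, fun hX => ?_⟩⟩
  · rw [← hespan]
    exact ⟨_, (isPKAWV_iff he hlam x y _).2 rfl, fun g hg => (isPKAWV_iff he hlam x y g).1 hg⟩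
  · rw [← hespan] at hf
    have hτ : ∀ t < n, ‖kernelSection H (x t) - ∑ i, evalFeature e x t i • e i‖ ^ 2 ≤
        Real.exp (-M) / 8 := fun t ht =>
      kernelSection_approximation hσ happ ((le_max_left _ _).trans hceil) he
        (hespan.trans hspan) (hx t ht)
    have h1 := regret_le he hlam hk hτ hy hf f
    have hpos : (kernelMatrix σ n x).PosSemidef := by
      have : kernelMatrix σ n x =
          Matrix.gram ℝ fun i : Fin n => kernelSection H (x i) := by
        ext i j
        rw [Matrix.gram_apply, inner_kernelSection, kernelSection_apply hk]
        rfl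
      exact this ▸ Matrix.posSemidef_gram ℝ _
    have h2 := approximation_cost_le hlam hn ((le_max_right _ _).trans hceil) x hpos
    have h3 := mul_le_mul_of_nonneg_right h2 (sq_nonneg B)
    have h4 : (n : ℝ) ^ 2 * (Real.exp (-M) / 8) * B ^ 2 / lam =
        n ^ 2 * (Real.exp (-M) / 8) / lam * B ^ 2 := by ring
    rw [h4] at h1
    linarith
  -- With interior points the Taylor functions are an orthonormal basis themselves, so the
  -- coordinates of the forecaster are those the program computes.
  · have he' : Orthonormal ℝ fun i => G (storedIndex M d i) :=
      (horth hX).comp _ (storedIndex_injective M d)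
    rw [hspan] at hf
    have hfeat : evalFeature (fun i => G (storedIndex M d i)) x =
        storedFeature σ M fun t => (x t : EuclideanSpace ℝ (Fin d)) := by
      funext t i
      exact hG _ _
    have hfhat := (isPKAWV_iff he' hlam x y fhat).1 hf
    have hval : (fun t => fhat t (x t)) = fun t =>
        storedFeature σ M (fun t => (x t : EuclideanSpace ℝ (Fin d))) t ⬝ᵥ
          forecastWeight lam (storedFeature σ M fun t => (x t : EuclideanSpace ℝ (Fin d))) y t := by
      funext t
      rw [hfhat, sum_smul_eval, hfeat]
    rw [hval]
    refine forecastProgram_runs hd hlam n ?_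
    exact (mul_le_mul_of_nonneg_left (taylorOrder_pow_le hd hlam hn hM)
      (by positivity : (0 : ℝ) ≤ 1000 * ((d : ℝ) + 3) ^ 2)).trans_eq (mul_assoc _ _ _).symm
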